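/- Let $n\ge 1$ and $m$ be integers with $r:=m-n>0$. Consider the sequences of $m$ insertions of single arcs (ordered pairs $(i,j)\in[n]^2$, loops and repetitions allowed) into the empty digraph on $[n]=\{1,\dots,n\}$ such that in the resulting multi-digraph every in-degree and every out-degree (counted with multiplicity) is at least $1$; choose one of them uniformly at random, and let $MG_{1,1}(n,m)$ be the resulting random multi-digraph. A nonempty set $S\subseteq[n]$ is a sink-set (source-set) if there is no arc $i\to j$ (respectively $j\to i$) with $i\in S$, $j\notin S$; it is simple if all out-degrees (respectively in-degrees) of the sub-multi-digraph induced by $S$ are equal to $1$. Let $X$ be the total length of the directed cycles (a loop being a cycle of length $1$) contained in simple sink-sets or simple source-sets, each cycle counted once. Then $X=0$ if and only if there is no simple sink-set and no simple source-set, and, as $r\to\infty$ with $m=O(n)$, $$ \Pr(X=0)=\frac{\left(1-\dfrac{\lambda}{e^{\lambda}-1}\right)^2}{1-\dfrac{\lambda}{e^{\lambda}(e^{\lambda}-1)}}\,\bigl(1+O(r^{-1}\ln^2 r)\bigr), $$ where $\lambda>0$ is the unique positive root of $\dfrac{\lambda e^{\lambda}}{e^{\lambda}-1}=\dfrac mn$.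 That is, for every constant $C$ there are constants $K$ and $R$, depending only on $C$, such that for all $n\ge1$ and $m$ with $n+R\le m\le Cn$ the ratio of $\Pr(X=0)$ to the displayed quotient differs from $1$ by at most $K\,r^{-1}\ln^2 r$. -/

import Mathlib

/-- A multi-digraph on the vertex set `V` (loops and multiple arcs allowed), given by its arc
multiplicities: `μ i j` is the number of arcs `i → j`. -/
abbrev MultiDigraph (V : Type) := V → V → ℕ

namespace MultiDigraph

variable {V : Type} [Fintype V]

/-- The out-degree of `i`, counted with multiplicity. -/
def outDeg (μ : MultiDigraph V) (i : V) : ℕ := ∑ j, μ i j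

/-- The in-degree of `j`, counted with multiplicity. -/
def inDeg (μ : MultiDigraph V) (j : V) : ℕ := ∑ i, μ i j

/-- `S` is a sink-set: there is no arc `i → j` with `i ∈ S`, `j ∉ S`. -/
def IsSinkSet (μ : MultiDigraph V) (S : Finset V) : Prop :=
  ∀ i ∈ S, ∀ j ∉ S, μ i j = 0

/-- `S` is a source-set: there is no arc `j → i` with `i ∈ S`, `j ∉ S`. -/
def IsSourceSet (μ : MultiDigraph V) (S : Finset V) : Prop :=
  ∀ i ∈ S, ∀ j ∉ S, μ j i = 0

/-- A nonempty sink-set `S` such that all out-degrees of the sub-multi-digraph induced by `S`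
are equal to `1`. -/
def IsSimpleSinkSet (μ : MultiDigraph V) (S : Finset V) : Prop :=
  S.Nonempty ∧ μ.IsSinkSet S ∧ ∀ i ∈ S, ∑ j ∈ S, μ i j = 1

/-- A nonempty source-set `S` such that all in-degrees of the sub-multi-digraph induced by `S`
are equal to `1`. -/
def IsSimpleSourceSet (μ : MultiDigraph V) (S : Finset V) : Prop :=
  S.Nonempty ∧ μ.IsSourceSet S ∧ ∀ j ∈ S, ∑ i ∈ S, μ i j = 1

/-- There are neither simple sink-sets nor simple source-sets. -/
def NoSimpleSets (μ : MultiDigraph V) : Prop :=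
  ∀ S : Finset V, ¬ μ.IsSimpleSinkSet S ∧ ¬ μ.IsSimpleSourceSet S

/-- `c 0 → c 1 → ⋯ → c k → c 0` is a directed cycle on `k + 1` distinct vertices. The addition
in `Fin (k + 1)` is cyclic; `k = 0` gives a loop. -/
def IsDirectedCycle (μ : MultiDigraph V) {k : ℕ} (c : Fin (k + 1) → V) : Prop :=
  Function.Injective c ∧ ∀ i, 0 < μ (c i) (c (i + 1))

/-- The vertices lying on the directed cycles contained in simple sink-sets or in simple
source-sets. -/
def simpleCycleVertices (μ : MultiDigraph V) : Set V :=
  {v | ∃ S : Finset V, (μ.IsSimpleSinkSet S ∨ μ.IsSimpleSourceSet S) ∧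
    ∃ (k : ℕ) (c : Fin (k + 1) → V), μ.IsDirectedCycle c ∧ (∀ i, c i ∈ S) ∧ v ∈ Set.range c}

/-- The total length of the cycles in all simple sink-sets and source-sets. Two such cycles that
share a vertex coincide, so the total length is the number of vertices on these cycles. -/
noncomputable def X (μ : MultiDigraph V) : ℕ := μ.simpleCycleVertices.ncard

end MultiDigraph

/-- The multi-digraph on `n` vertices that results from the `m`-long sequence of arc insertions
`s`, where `s t = (i, j)` means that the `t`-th inserted arc is `i → j`. -/
def resultingMultiDigraph {n m : ℕ} (s : Fin m → Fin n × Fin n) : MultiDigraph (Fin n) :=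
  fun i j => (Finset.univ.filter fun t => s t = (i, j)).card

/-- The `m`-long insertion sequences that result in a multi-digraph on `n` vertices all of whose
in-degrees and out-degrees are positive. -/
def insertionSeqs (n m : ℕ) : Finset (Fin m → Fin n × Fin n) :=
  Finset.univ.filter fun s =>
    ∀ i, 0 < (resultingMultiDigraph s).outDeg i ∧ 0 < (resultingMultiDigraph s).inDeg i

open Classical in
/-- The probability that the random multi-digraph `MG_{1,1}(n,m)`, which results from a uniformly
random element of `insertionSeqs n m`, has the property `E`. -/
noncomputable def probMG (n m : ℕ) (E : MultiDigraph (Fin n) → Prop) : ℝ :=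
  (((insertionSeqs n m).filter fun s => E (resultingMultiDigraph s)).card : ℝ) /
    ((insertionSeqs n m).card : ℝ)

/-- `lam` is a positive solution of `λ e^λ / (e^λ - 1) = m / n`. -/
def IsPoissonParam (n m : ℕ) (lam : ℝ) : Prop :=
  0 < lam ∧ lam * Real.exp lam / (Real.exp lam - 1) = (m : ℝ) / (n : ℝ)

/-- The leading term `(1 - λ/(e^λ - 1))² / (1 - λ/(e^λ (e^λ - 1)))`. -/
noncomputable def leadingTerm (lam : ℝ) : ℝ :=
  (1 - lam / (Real.exp lam - 1)) ^ 2 /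
    (1 - lam / (Real.exp lam * (Real.exp lam - 1)))

/-!
A uniformly random element of `insertionSeqs n m` is a pair of independent uniformly random
surjections `f, g` from the `m` times onto the `n` vertices, the tails and the heads of the arcs.
There is a simple sink-set exactly if there is a cycle all of whose vertices have out-degree `1`, and
similarly for source-sets, so `X = 0` says that there are no such cycles. Let `r = m - n`, and let
`S_j` be the number of surjections of `m - j` points onto `n - j` points.

**Exact formula.** Let `M` be the matrix whose rows belonging to vertices of out-degree `1` are those
of the adjacency matrix, the other rows being zero. Then `det (1 - M)` is the indicator of the absence
of simple sink-sets (`sum_sign_follows`). Expanding this determinant and the corresponding one for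
source-sets gives a signed sum over permutations `σ` of a set `U` of vertices with one out-arc and
`τ` of a set `W` of vertices with one in-arc. If `U \ W` contains two vertices, exchanging the heads
of their out-arcs changes the sign, so only the pairs with `#(U \ W), #(W \ U) ≤ 1` survive
(`sum_sign_followCount_eq_zero`), and for those `U ∩ W` carries isolated cycles while the possible
further vertices carry loops. Counting gives the single sum `natCard_no_soleClosed_eq`. Divided by the
total number `S_0 ^ 2`, it becomes the positive sum `probMG_eq_sum`
`∑ j, a_j * ((1 - u_j) ^ 2 + small)`, where `u_j = (m - j) S_{j+1} / S_j` is the probability that a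
given vertex has out-degree `1` in the model with `n - j` vertices and `m - j` arcs, and
`a_{j+1} = a_j u_j ^ 2 (n - j) / (m - j)`.

**Mean value.** `a_j (1 - u_j) ^ 2 = (a_j - a_{j+1}) F_j`, where `F_j` is the quotient
`(1 - u) ^ 2 / (1 - u ^ 2 n / m)` for the `j`-th model, so the sum is a mean of the `F_j`. As `u` is
monotone and changes slowly with the number of vertices (`loneProb_le_succ_left`,
`succ_mul_loneProb_le`), `F_j / F_0` lies between `(n - j) / n` and `(n / (n - j)) ^ 3`; as the
weights `a_j` decay geometrically at rate `1 - O(r / m)`, the mean is `F_0 (1 + O(1 / r))`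
(`loneQuot_mul_le_probMG`, `probMG_le_loneQuot_mul`).

**Poisson approximation.** Let `c_r = S_0 / m!` be the coefficient of `X ^ r` in
`((e ^ X - 1) / X) ^ n`, and let `v` be the ratio `c_{r-1} / c_r`. Then `u + v = m / n`, and
splitting off the fibre of one vertex gives `1 / u = ∑ k, v^k / (k + 1)!` up to `O(1 / n)`, i.e.
`u = v / (e ^ v - 1) + O(1 / n)`, because `v` is Lipschitz in both parameters with constant `O(1 / n)`.
As `λ / (e ^ λ - 1) + λ = m / n` as well, `u` differs from `λ / (e ^ λ - 1)` by `O(1 / n)`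
(`abs_loneProb_sub_le`). Since `1 - u` is of order `r / n`, this is a relative error `O(1 / r)`
of `1 - u`, hence of `F_0`. Altogether the relative error is `O(1 / r)`, which is stronger than
`O(r⁻¹ log ^ 2 r)`.
-/

/-! ### Counting surjections -/

/-- The number of surjections from an `m`-element set onto an `n`-element set. -/
noncomputable def surjCount (n m : ℕ) : ℕ :=
  Nat.card {f : Fin m → Fin n // Function.Surjective f}

theorem natCard_surjective {α β : Type*} [Fintype α] [Fintype β] :
    Nat.card {f : α → β // Function.Surjective f} =
      surjCount (Fintype.card β) (Fintype.card α) := by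
  classical
  refine Nat.card_congr (Equiv.subtypeEquiv
    (Equiv.arrowCongr (Fintype.equivFin α) (Fintype.equivFin β)) fun f => ?_)
  simp [Equiv.arrowCongr]

/-- Surjections with prescribed one-point fibres are surjections between the complements. -/
theorem natCard_surjective_pinned {ι α β : Type*} [Fintype ι] [Fintype α] [Fintype β]
    (a : ι ↪ β) (t : ι ↪ α) :
    Nat.card {f : α → β // Function.Surjective f ∧ ∀ i s, f s = a i ↔ s = t i} =
      surjCount (Fintype.card β - Fintype.card ι) (Fintype.card α - Fintype.card ι) := by
  classical
  have key : Nat.card {f : α → β // Function.Surjective f ∧ ∀ i s, f s = a i ↔ s = t i} =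
      Nat.card {h : {s // s ∉ Set.range t} → {b // b ∉ Set.range a} // Function.Surjective h} := by
    refine Nat.card_congr
      { toFun := fun f => ⟨fun s => ⟨f.1 s.1, ?_⟩, ?_⟩
        invFun := fun h => ⟨fun s => if hs : s ∈ Set.range t then a hs.choose else h.1 ⟨s, hs⟩,
          ?_, ?_⟩
        left_inv := ?_
        right_inv := ?_ }
    · rintro ⟨i, hi⟩
      exact s.2 ⟨i, (((f.2.2 i s.1).1 hi.symm)).symm⟩
    · rintro ⟨b, hb⟩
      obtain ⟨s, rfl⟩ := f.2.1 b
      exact ⟨⟨s, fun ⟨i, hi⟩ => hb ⟨i, ((f.2.2 i s).2 hi.symm).symm⟩⟩, rfl⟩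
    · intro b
      by_cases hb : b ∈ Set.range a
      · obtain ⟨i, rfl⟩ := hb
        have hs : t i ∈ Set.range t := ⟨i, rfl⟩
        refine ⟨t i, ?_⟩
        simp only [hs, dif_pos]
        exact congrArg a (t.injective hs.choose_spec)
      · obtain ⟨⟨s, hs⟩, h'⟩ := h.2 ⟨b, hb⟩
        exact ⟨s, by simp only [hs, dif_neg, not_false_iff, h']⟩
    · intro i s
      by_cases hs : s ∈ Set.range t
      · simp only [hs, dif_pos]
        have := hs.choose_spec
        constructor
        · intro h'
          rw [← this, a.injective h']
        · intro h'
          exact congrArg a (t.injective (this.trans h'))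
      · simp only [hs, dif_neg, not_false_iff]
        constructor
        · intro h'
          exact absurd ⟨i, h'.symm⟩ (h.1 ⟨s, hs⟩).2
        · rintro rfl
          exact absurd ⟨i, rfl⟩ hs
    · rintro ⟨f, hf, hp⟩
      ext s
      by_cases hs : s ∈ Set.range t
      · simp only [hs, dif_pos]
        exact ((hp _ s).2 hs.choose_spec.symm).symm
      · simp only [hs, dif_neg, not_false_iff]
    · rintro ⟨h, hh⟩
      ext ⟨s, hs⟩
      simp only [hs, dif_neg, not_false_iff]
  have hcα : Fintype.card {s // s ∉ Set.range t} = Fintype.card α - Fintype.card ι := by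
    rw [Fintype.card_subtype_compl, Set.card_range_of_injective t.injective]
  have hcβ : Fintype.card {s // s ∉ Set.range a} = Fintype.card β - Fintype.card ι := by
    rw [Fintype.card_subtype_compl, Set.card_range_of_injective a.injective]
  rw [key, natCard_surjective, hcα, hcβ]

/-- By symmetry, the value at a further point is equally distributed over the remaining targets. -/
theorem natCard_surjective_pinned_value {ι α β : Type*} [Fintype ι] [Fintype α] [Fintype β]
    (a : ι ↪ β) (t : ι ↪ α) (w : β) (hw : w ∉ Set.range a) (s₀ : α) (hs₀ : s₀ ∉ Set.range t) :
    (Fintype.card β - Fintype.card ι) *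
      Nat.card {f : α → β // (Function.Surjective f ∧ ∀ i s, f s = a i ↔ s = t i) ∧ f s₀ = w} =
      surjCount (Fintype.card β - Fintype.card ι) (Fintype.card α - Fintype.card ι) := by
  classical
  rw [← natCard_surjective_pinned a t]
  set P : (α → β) → Prop := fun f => Function.Surjective f ∧ ∀ i s, f s = a i ↔ s = t i with hP
  have hsym : ∀ b ∉ Set.range a, Nat.card {f : α → β // P f ∧ f s₀ = b} =
      Nat.card {f : α → β // P f ∧ f s₀ = w} := by
    intro b hb
    have aux : ∀ b ∉ Set.range a, ∀ b' ∉ Set.range a, ∀ f, P f ∧ f s₀ = b →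
        P (Equiv.swap b b' ∘ f) ∧ (Equiv.swap b b' ∘ f) s₀ = b' := by
      rintro b hb b' hb' f ⟨⟨hf, hp⟩, rfl⟩
      refine ⟨⟨(Equiv.surjective _).comp hf, fun i s => ?_⟩, by simp⟩
      rw [← hp i s, Function.comp_apply, Equiv.swap_apply_eq_iff,
        Equiv.swap_apply_of_ne_of_ne (fun h => hb ⟨i, h⟩) (fun h => hb' ⟨i, h⟩)]
    refine Nat.card_congr
      { toFun := fun f => ⟨Equiv.swap b w ∘ f.1, aux b hb w hw f.1 f.2⟩
        invFun := fun f => ⟨Equiv.swap b w ∘ f.1, by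
          rw [Equiv.swap_comm]; exact aux w hw b hb f.1 f.2⟩
        left_inv := fun f => by ext s; simp
        right_inv := fun f => by ext s; simp }
  have hsum : Nat.card {f : α → β // P f} =
      ∑ b : {b // b ∉ Set.range a}, Nat.card {f : α → β // P f ∧ f s₀ = b.1} := by
    rw [← Nat.card_sigma]
    refine Nat.card_congr
      { toFun := fun f => ⟨⟨f.1 s₀, ?_⟩, ⟨f.1, f.2, rfl⟩⟩
        invFun := fun x => ⟨x.2.1, x.2.2.1⟩
        left_inv := fun f => rfl
        right_inv := ?_ }
    · rintro ⟨i, hi⟩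
      exact hs₀ ⟨i, ((f.2.2 i s₀).1 hi.symm).symm⟩
    · rintro ⟨⟨b, hb⟩, f, hf, h⟩
      obtain rfl : f s₀ = b := h
      rfl
  rw [hsum, Finset.sum_congr rfl fun b _ => hsym b.1 b.2, Finset.sum_const, Finset.card_univ,
    Fintype.card_subtype_compl, Set.card_range_of_injective a.injective, smul_eq_mul]

theorem surjCount_zero_zero : surjCount 0 0 = 1 := by
  rw [surjCount, Nat.card_eq_one_iff_unique]
  exact ⟨⟨fun f g => by ext i; exact i.elim0⟩, ⟨⟨fun i => i.elim0, fun i => i.elim0⟩⟩⟩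

theorem surjCount_zero_succ (m : ℕ) : surjCount 0 (m + 1) = 0 := by
  rw [surjCount, Nat.card_eq_zero]
  exact Or.inl ⟨fun f => (f.1 0).elim0⟩

theorem surjCount_eq_zero_of_lt {n m : ℕ} (h : m < n) : surjCount n m = 0 := by
  rw [surjCount, Nat.card_eq_zero]
  refine Or.inl ⟨fun f => ?_⟩
  have := Fintype.card_le_of_surjective _ f.2
  simp at this
  omega

theorem surjCount_pos {n m : ℕ} (hn : 0 < n) (h : n ≤ m) : 0 < surjCount n m := by
  rw [surjCount, Nat.card_pos_iff]
  refine ⟨⟨⟨fun i => ⟨min i.1 (n - 1), by omega⟩, fun j => ⟨⟨j.1, by omega⟩, ?_⟩⟩⟩, inferInstance⟩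
  ext
  simp
  omega

/-- Splitting according to whether the last point is alone in its fibre. -/
theorem surjCount_succ_succ (n m : ℕ) :
    surjCount (n + 1) (m + 1) = (n + 1) * (surjCount (n + 1) m + surjCount n m) := by
  classical
  have hstep : surjCount (n + 1) (m + 1) = ∑ v : Fin (n + 1),
      (Nat.card {f : Fin (m + 1) → Fin (n + 1) //
          Function.Surjective f ∧ ∀ (_ : Unit) s, f s = v ↔ s = 0} +
        Nat.card {f : Fin m → Fin (n + 1) // Function.Surjective f}) := by
    simp_rw [← Nat.card_sum]
    rw [← Nat.card_sigma, surjCount]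
    symm
    refine Nat.card_congr (Equiv.ofBijective (fun x => match x with
      | ⟨_, Sum.inl f⟩ => ⟨f.1, f.2.1⟩
      | ⟨v, Sum.inr f⟩ => ⟨Fin.cons v f.1, fun b => ?_⟩) ⟨?_, ?_⟩)
    · obtain ⟨s, hs⟩ := f.2 b
      exact ⟨s.succ, by simpa using hs⟩
    · rintro ⟨v, ⟨f, hf⟩ | ⟨f, hf⟩⟩ ⟨w, ⟨g, hg⟩ | ⟨g, hg⟩⟩ h
      · obtain rfl : f = g := congrArg Subtype.val h
        have : v = w := by rw [← (hf.2 () 0).2 rfl, ← (hg.2 () 0).2 rfl]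
        subst this
        rfl
      · obtain rfl : f = Fin.cons w g := congrArg Subtype.val h
        have hv : w = v := by simpa using (hf.2 () 0).2 rfl
        obtain ⟨s, hs⟩ := hg v
        exact absurd ((hf.2 () s.succ).1 (by simpa using hs)) (Fin.succ_ne_zero s)
      · obtain rfl : Fin.cons v f = g := congrArg Subtype.val h
        have hv : v = w := by simpa using (hg.2 () 0).2 rfl
        obtain ⟨s, hs⟩ := hf w
        exact absurd ((hg.2 () s.succ).1 (by simpa using hs)) (Fin.succ_ne_zero s)
      · have h' : (Fin.cons v f : Fin (m + 1) → Fin (n + 1)) = Fin.cons w g :=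
          congrArg Subtype.val h
        obtain ⟨rfl, rfl⟩ := Fin.cons_inj.1 h'
        rfl
    · rintro ⟨f, hf⟩
      by_cases h : ∀ s, f s = f 0 ↔ s = 0
      · exact ⟨⟨f 0, Sum.inl ⟨f, hf, fun _ => h⟩⟩, rfl⟩
      · have h' : ∃ s : Fin m, f s.succ = f 0 := by
          by_contra hcon
          push Not at hcon
          refine h fun s => ⟨fun hs => ?_, fun hs => by rw [hs]⟩
          by_contra hs0
          obtain ⟨s', rfl⟩ := Fin.exists_succ_eq.2 hs0
          exact hcon s' hs
        refine ⟨⟨f 0, Sum.inr ⟨fun s => f s.succ, fun b => ?_⟩⟩, ?_⟩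
        · obtain ⟨s, rfl⟩ := hf b
          rcases Fin.eq_zero_or_eq_succ s with rfl | ⟨s', rfl⟩
          · exact h'
          · exact ⟨s', rfl⟩
        · exact Subtype.ext (Fin.cons_self_tail f)
  rw [hstep]
  have h1 : ∀ v : Fin (n + 1), Nat.card {f : Fin (m + 1) → Fin (n + 1) //
      Function.Surjective f ∧ ∀ (_ : Unit) s, f s = v ↔ s = 0} = surjCount n m := by
    intro v
    have := natCard_surjective_pinned (ι := Unit) (α := Fin (m + 1)) (β := Fin (n + 1))
      ⟨fun _ => v, fun _ _ _ => rfl⟩ ⟨fun _ => 0, fun _ _ _ => rfl⟩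
    exact this.trans (by simp)
  rw [Finset.sum_congr rfl fun v _ => by rw [h1 v], Finset.sum_const]
  simp only [Finset.card_univ, Fintype.card_fin, smul_eq_mul, surjCount]
  ring

/-! ### Signed expansion of the absence of simple sink-sets -/

section SignedExpansion

open Finset Function

variable {V T : Type*}

/-- For the digraph whose `t`-th arc is `f t → g t`: exactly one arc leaves `x`, and it ends in `y`.
Exchanging `f` and `g` gives the corresponding notion for entering arcs. -/
def SoleArc (f g : T → V) (x y : V) : Prop := ∃ t, (∀ s, f s = x ↔ s = t) ∧ g t = y

theorem SoleArc.unique {f g : T → V} {x y z : V} (h : SoleArc f g x y) (h' : SoleArc f g x z) :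
    y = z := by
  obtain ⟨t, ht, rfl⟩ := h
  obtain ⟨t', ht', rfl⟩ := h'
  rw [(ht' t).1 ((ht t).2 rfl)]

/-- There is a nonempty set `S` each of whose vertices has exactly one out-arc, ending in `S`. -/
def HasSoleClosed (f g : T → V) : Prop :=
  ∃ S : Finset V, S.Nonempty ∧ ∀ x ∈ S, ∃ y ∈ S, SoleArc f g x y

/-- The permutation `σ` moves only points of `U`, and for each `x ∈ U` the arc `x → σ x` is the
only arc leaving `x`. -/
def Follows (U : Finset V) (σ : Equiv.Perm V) (f g : T → V) : Prop :=
  (∀ x ∉ U, σ x = x) ∧ ∀ x ∈ U, SoleArc f g x (σ x)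

theorem perm_apply_mem_of_fixes_compl {U : Finset V} {σ : Equiv.Perm V}
    (h : ∀ x ∉ U, σ x = x) {x : V} (hx : x ∈ U) : σ x ∈ U := by
  by_contra hc
  have := σ.injective (h _ hc)
  rw [this] at hc
  exact hc hx

theorem perm_inv_apply_of_fixes_compl {U : Finset V} {σ : Equiv.Perm V}
    (h : ∀ x ∉ U, σ x = x) : ∀ x ∉ U, σ⁻¹ x = x := by
  intro x hx
  rw [Equiv.Perm.inv_eq_iff_eq, h x hx]

open scoped Classical in
/-- The signed sum is `det (1 - M)`, where `M x y = 1` if `SoleArc f g x y` and `M x y = 0`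
otherwise. It vanishes if there is a simple sink-set, because the indicator of the largest one is a
fixed vector of `M`; otherwise only `U = ∅` contributes. -/
theorem sum_sign_follows [Fintype V] [DecidableEq V] (f g : T → V) :
    ∑ U : Finset V, ∑ σ : Equiv.Perm V,
      (-1 : ℤ) ^ #U * (Equiv.Perm.sign σ : ℤ) * (if Follows U σ f g then 1 else 0) =
    if HasSoleClosed f g then 0 else 1 := by
  split_ifs with h
  · set M : Matrix V V ℤ := fun x y => if SoleArc f g x y then 1 else 0 with hM
    have hdet : ∑ U : Finset V, ∑ σ : Equiv.Perm V,
        (-1 : ℤ) ^ #U * (Equiv.Perm.sign σ : ℤ) * (if Follows U σ f g then 1 else 0) =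
        (1 - M).det := by
      rw [← Matrix.det_transpose, Matrix.det_apply, sum_comm]
      refine sum_congr rfl fun σ _ => ?_
      have : ∏ i, (1 - M).transpose (σ i) i =
          ∏ i, (-M i (σ i) + (if σ i = i then 1 else 0)) := by
        refine prod_congr rfl fun i _ => ?_
        rw [Matrix.transpose_apply, Matrix.sub_apply, Matrix.one_apply]
        simp only [eq_comm (a := i)]
        ring
      rw [this, prod_add, powerset_univ, Units.smul_def, smul_eq_mul, mul_sum]
      refine sum_congr rfl fun U _ => ?_
      have h1 : ∏ i ∈ univ \ U, (if σ i = i then (1 : ℤ) else 0) =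
          if ∀ x ∉ U, σ x = x then 1 else 0 := by
        rw [prod_ite_zero]
        simp
      have h2 : ∏ i ∈ U, -M i (σ i) =
          (-1) ^ #U * if ∀ x ∈ U, SoleArc f g x (σ x) then 1 else 0 := by
        rw [prod_neg, hM, prod_ite_zero]
        simp
      rw [h1, h2]
      by_cases hF : Follows U σ f g
      · rw [if_pos hF, if_pos hF.2, if_pos hF.1]
        ring
      · rw [if_neg hF]
        by_cases ha : ∀ x ∉ U, σ x = x
        · rw [if_neg fun hb => hF ⟨ha, hb⟩]
          ring
        · rw [if_neg ha]
          ring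
    rw [hdet, ← Matrix.exists_mulVec_eq_zero_iff]
    set C : Finset (Finset V) := univ.filter fun S => ∀ x ∈ S, ∃ y ∈ S, SoleArc f g x y with hC
    set S : Finset V := C.biUnion id with hS
    have hSc : ∀ x ∈ S, ∃ y ∈ S, SoleArc f g x y := by
      intro x hx
      obtain ⟨S', hS', hx'⟩ := mem_biUnion.1 hx
      obtain ⟨y, hy, hxy⟩ := (mem_filter.1 hS').2 x hx'
      exact ⟨y, mem_biUnion.2 ⟨S', hS', hy⟩, hxy⟩
    have hmax : ∀ x, (∃ y ∈ S, SoleArc f g x y) → x ∈ S := by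
      rintro x ⟨y, hy, hxy⟩
      refine mem_biUnion.2 ⟨insert x S, mem_filter.2 ⟨mem_univ _, fun z hz => ?_⟩,
        mem_insert_self x S⟩
      rcases mem_insert.1 hz with rfl | hz
      · exact ⟨y, mem_insert_of_mem hy, hxy⟩
      · obtain ⟨w, hw, hzw⟩ := hSc z hz
        exact ⟨w, mem_insert_of_mem hw, hzw⟩
    refine ⟨fun x => if x ∈ S then 1 else 0, fun h0 => ?_, ?_⟩
    · obtain ⟨S', ⟨x, hx⟩, hS'⟩ := h
      have hxS : x ∈ S := mem_biUnion.2 ⟨S', mem_filter.2 ⟨mem_univ _, hS'⟩, hx⟩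
      have := congrFun h0 x
      simp [hxS] at this
    · rw [Matrix.sub_mulVec, Matrix.one_mulVec, sub_eq_zero]
      ext x
      simp only [Matrix.mulVec, dotProduct, hM]
      by_cases hx : x ∈ S
      · obtain ⟨y, hy, hxy⟩ := hSc x hx
        rw [sum_eq_single y]
        · simp [hx, hy, hxy]
        · intro z _ hz
          rw [if_neg fun hz' => hz (hz'.unique hxy), zero_mul]
        · simp
      · rw [if_neg hx, sum_eq_zero]
        intro y _
        by_cases hy : y ∈ S
        · rw [if_neg fun hxy => hx (hmax x ⟨y, hy, hxy⟩), zero_mul]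
        · rw [if_neg hy, mul_zero]
  · rw [sum_eq_single ∅, sum_eq_single 1]
    · simp [Follows]
    · intro σ _ hσ
      rw [if_neg, mul_zero]
      exact fun hF => hσ (Equiv.ext fun x => hF.1 x (notMem_empty x))
    · simp
    · intro U _ hU
      refine sum_eq_zero fun σ _ => ?_
      rw [if_neg, mul_zero]
      exact fun hF => h ⟨U, nonempty_iff_ne_empty.2 hU, fun x hx =>
        ⟨σ x, perm_apply_mem_of_fixes_compl hF.1 hx, hF.2 x hx⟩⟩
    · simp

/-- The number of pairs of surjections `f, g` such that `σ` follows sole out-arcs on `U` and `τ`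
follows sole in-arcs, backwards, on `W`. -/
noncomputable def followCount (T : Type*) (U : Finset V) (σ : Equiv.Perm V) (W : Finset V)
    (τ : Equiv.Perm V) : ℕ :=
  Nat.card {p : (T → V) × (T → V) // (Surjective p.1 ∧ Surjective p.2) ∧
    Follows U σ p.1 p.2 ∧ Follows W τ p.2 p.1}

theorem natCard_no_soleClosed [Fintype V] [DecidableEq V] [Fintype T] :
    (Nat.card {p : (T → V) × (T → V) // (Surjective p.1 ∧ Surjective p.2) ∧
      ¬ HasSoleClosed p.1 p.2 ∧ ¬ HasSoleClosed p.2 p.1} : ℤ) =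
    ∑ U : Finset V, ∑ W : Finset V, (-1 : ℤ) ^ (#U + #W) *
      ∑ σ : Equiv.Perm V, ∑ τ : Equiv.Perm V,
        (Equiv.Perm.sign σ : ℤ) * (Equiv.Perm.sign τ : ℤ) * (followCount T U σ W τ : ℤ) := by
  classical
  have hcard : ∀ P : (T → V) × (T → V) → Prop,
      (Nat.card {p : (T → V) × (T → V) // (Surjective p.1 ∧ Surjective p.2) ∧ P p} : ℤ) =
      ∑ p ∈ (univ : Finset ((T → V) × (T → V))) with (Surjective p.1 ∧ Surjective p.2),
        if P p then 1 else 0 := by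
    intro P
    rw [Nat.card_eq_fintype_card, Fintype.card_subtype, ← filter_filter, card_filter]
    push_cast
    rfl
  rw [hcard]
  simp_rw [followCount, hcard]
  have hexp : ∀ p : (T → V) × (T → V),
      (if ¬ HasSoleClosed p.1 p.2 ∧ ¬ HasSoleClosed p.2 p.1 then (1 : ℤ) else 0) =
      ∑ U : Finset V, ∑ W : Finset V, (-1 : ℤ) ^ (#U + #W) *
      ∑ σ : Equiv.Perm V, ∑ τ : Equiv.Perm V,
        (Equiv.Perm.sign σ : ℤ) * (Equiv.Perm.sign τ : ℤ) *
        (if Follows U σ p.1 p.2 ∧ Follows W τ p.2 p.1 then 1 else 0) := by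
    intro p
    have h1 := sum_sign_follows p.1 p.2
    have h2 := sum_sign_follows p.2 p.1
    have : (if ¬ HasSoleClosed p.1 p.2 ∧ ¬ HasSoleClosed p.2 p.1 then (1 : ℤ) else 0) =
        (if HasSoleClosed p.1 p.2 then 0 else 1) * (if HasSoleClosed p.2 p.1 then 0 else 1) := by
      split_ifs <;> simp_all
    rw [this, ← h1, ← h2, sum_mul_sum]
    refine sum_congr rfl fun U _ => sum_congr rfl fun W _ => ?_
    rw [sum_mul_sum, mul_sum]
    refine sum_congr rfl fun σ _ => ?_
    rw [mul_sum]
    refine sum_congr rfl fun τ _ => ?_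
    rw [ite_and, pow_add]
    split_ifs <;> ring
  refine Eq.trans (sum_congr rfl fun p _ => (?_ : _ = ∑ U : Finset V, ∑ W : Finset V,
    (-1 : ℤ) ^ (#U + #W) * ∑ σ : Equiv.Perm V, ∑ τ : Equiv.Perm V,
        (Equiv.Perm.sign σ : ℤ) * (Equiv.Perm.sign τ : ℤ) *
        (if Follows U σ p.1 p.2 ∧ Follows W τ p.2 p.1 then 1 else 0))) ?_
  · convert hexp p
  rw [sum_comm]
  refine sum_congr rfl fun U _ => ?_
  rw [sum_comm]
  refine sum_congr rfl fun W _ => ?_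
  rw [← mul_sum, sum_comm]
  congr 1
  refine sum_congr rfl fun σ _ => ?_
  rw [sum_comm]
  refine sum_congr rfl fun τ _ => ?_
  rw [mul_sum]
  exact sum_congr rfl fun p _ => by congr

theorem followCount_comm (U W : Finset V) (σ τ : Equiv.Perm V) :
    followCount T U σ W τ = followCount T W τ U σ := by
  refine Nat.card_congr (Equiv.subtypeEquiv (Equiv.prodComm _ _) fun p => ?_)
  simp only [Equiv.prodComm_apply, Prod.fst_swap, Prod.snd_swap]
  tauto

/-- Exchanging the heads of the sole out-arcs of two vertices `u`, `u'` of `U \ W` multiplies `σ`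
by a transposition. It does not disturb the arcs into `W`: both `u` and `u'` lie outside `W`, so
neither arc can be the sole in-arc of a vertex of `W` and both may be redirected. -/
theorem Follows.mul_swap [DecidableEq V] [DecidableEq T] {U W : Finset V} {σ τ : Equiv.Perm V}
    {f g : T → V} {u u' : V} (hu : u ∈ U \ W) (hu' : u' ∈ U \ W) {t t' : T} (ht : f t = u)
    (ht' : f t' = u') (hU : Follows U σ f g) (hW : Follows W τ g f) :
    Follows U (σ * Equiv.swap u u') f (g ∘ Equiv.swap t t') ∧
      Follows W τ (g ∘ Equiv.swap t t') f := by
  rw [mem_sdiff] at hu hu'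
  have hfib : ∀ s, (f s = u ↔ s = t) := by
    obtain ⟨t₀, h₀, -⟩ := hU.2 u hu.1
    rw [(h₀ t).1 ht]
    exact h₀
  have hfib' : ∀ s, (f s = u' ↔ s = t') := by
    obtain ⟨t₀, h₀, -⟩ := hU.2 u' hu'.1
    rw [(h₀ t').1 ht']
    exact h₀
  have hgt : g t = σ u := by
    obtain ⟨t₀, h₀, h₁⟩ := hU.2 u hu.1
    rw [(h₀ t).1 ht, h₁]
  have hgt' : g t' = σ u' := by
    obtain ⟨t₀, h₀, h₁⟩ := hU.2 u' hu'.1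
    rw [(h₀ t').1 ht', h₁]
  refine ⟨⟨fun x hx => ?_, fun x hx => ?_⟩, hW.1, fun w hw => ?_⟩
  · rw [Equiv.Perm.mul_apply, Equiv.swap_apply_of_ne_of_ne, hU.1 x hx]
    · rintro rfl; exact hx hu.1
    · rintro rfl; exact hx hu'.1
  · by_cases hxu : x = u
    · subst hxu
      exact ⟨t, hfib, by simp [hgt']⟩
    by_cases hxu' : x = u'
    · subst hxu'
      exact ⟨t', hfib', by simp [hgt]⟩
    obtain ⟨s, hs, hs'⟩ := hU.2 x hx
    have hfs := (hs s).2 rfl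
    refine ⟨s, hs, ?_⟩
    rw [Equiv.Perm.mul_apply, Equiv.swap_apply_of_ne_of_ne hxu hxu', comp_apply,
      Equiv.swap_apply_of_ne_of_ne, hs']
    · rintro rfl; exact hxu (hfs.symm.trans ht)
    · rintro rfl; exact hxu' (hfs.symm.trans ht')
  · obtain ⟨s, hs, hs'⟩ := hW.2 w hw
    have hτ := perm_apply_mem_of_fixes_compl hW.1 hw
    have hst : s ≠ t := by rintro rfl; rw [← hs', ht] at hτ; exact hu.2 hτ
    have hst' : s ≠ t' := by rintro rfl; rw [← hs', ht'] at hτ; exact hu'.2 hτ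
    refine ⟨s, fun z => ?_, hs'⟩
    rw [comp_apply, hs, Equiv.swap_apply_eq_iff, Equiv.swap_apply_of_ne_of_ne hst hst']

theorem followCount_mul_swap [DecidableEq V] {U W : Finset V} (σ τ : Equiv.Perm V) {u u' : V}
    (hu : u ∈ U \ W) (hu' : u' ∈ U \ W) :
    followCount T U (σ * Equiv.swap u u') W τ = followCount T U σ W τ := by
  classical
  refine Nat.card_congr
    { toFun := fun p => ⟨(p.1.1, p.1.2 ∘
          Equiv.swap (surjInv p.2.1.1 u) (surjInv p.2.1.1 u')),
        ⟨p.2.1.1, p.2.1.2.comp (Equiv.surjective _)⟩, ?_⟩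
      invFun := fun p => ⟨(p.1.1, p.1.2 ∘
          Equiv.swap (surjInv p.2.1.1 u) (surjInv p.2.1.1 u')),
        ⟨p.2.1.1, p.2.1.2.comp (Equiv.surjective _)⟩, ?_⟩
      left_inv := fun p => by ext s <;> simp
      right_inv := fun p => by ext s <;> simp }
  · have := p.2.2.1.mul_swap hu hu' (surjInv_eq p.2.1.1 u) (surjInv_eq p.2.1.1 u') p.2.2.2
    rwa [mul_assoc, Equiv.swap_mul_self, mul_one] at this
  · exact p.2.2.1.mul_swap hu hu' (surjInv_eq p.2.1.1 u) (surjInv_eq p.2.1.1 u') p.2.2.2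

/-- The exchange of heads is a sign-reversing involution, so the signed sum cancels. -/
theorem sum_sign_followCount_eq_zero [Fintype V] [DecidableEq V] {U W : Finset V}
    (h : 1 < #(U \ W)) (τ : Equiv.Perm V) :
    ∑ σ : Equiv.Perm V, (Equiv.Perm.sign σ : ℤ) * (followCount T U σ W τ : ℤ) = 0 := by
  obtain ⟨u, hu, u', hu', hne⟩ := one_lt_card.1 h
  have hX := Equiv.sum_comp (Equiv.mulRight (Equiv.swap u u'))
    fun σ : Equiv.Perm V => (Equiv.Perm.sign σ : ℤ) * (followCount T U σ W τ : ℤ)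
  simp only [Equiv.coe_mulRight, Equiv.Perm.sign_mul, Equiv.Perm.sign_swap hne,
    followCount_mul_swap _ τ hu hu', mul_neg, mul_one, Units.val_neg, neg_mul,
    sum_neg_distrib] at hX
  linarith

end SignedExpansion

/-! ### Evaluation of the signed expansion -/

section Evaluation

open Finset Function

variable {V T : Type*}

/-- When the exchange of heads is not available, `σ` moves only vertices of `U ∩ W`, and `τ` inverts
it there. -/
theorem Follows.fixes_compl_inter [DecidableEq V] {U W : Finset V} {σ τ : Equiv.Perm V}
    {f g : T → V} (hU : Follows U σ f g) (hW : Follows W τ g f) (h : #(U \ W) ≤ 1) :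
    (∀ x ∉ U ∩ W, σ x = x) ∧ ∀ x ∈ U ∩ W, τ (σ x) = x := by
  have hin : ∀ x ∈ U ∩ W, τ (σ x) = x ∧ σ x ∈ U ∩ W := by
    intro x hx
    rw [mem_inter] at hx
    have hx'W : τ⁻¹ x ∈ W :=
      perm_apply_mem_of_fixes_compl (perm_inv_apply_of_fixes_compl hW.1) hx.2
    obtain ⟨t, ht, hgt⟩ := hU.2 x hx.1
    obtain ⟨t', ht', hft'⟩ := hW.2 _ hx'W
    rw [show τ (τ⁻¹ x) = x from τ.apply_symm_apply x] at hft'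
    have h1 : t' = t := (ht t').1 hft'
    subst h1
    have h2 : g t' = τ⁻¹ x := (ht' t').2 rfl
    have h3 : σ x = τ⁻¹ x := hgt.symm.trans h2
    rw [mem_inter]
    refine ⟨by rw [h3]; exact τ.apply_symm_apply x, perm_apply_mem_of_fixes_compl hU.1 hx.1, ?_⟩
    rw [h3]
    exact hx'W
  refine ⟨fun x hx => ?_, fun x hx => (hin x hx).1⟩
  by_cases hxU : x ∈ U
  · have hxW : x ∉ W := fun hxW => hx (mem_inter.2 ⟨hxU, hxW⟩)
    have himg : (U ∩ W).image σ = U ∩ W :=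
      eq_of_subset_of_card_le (image_subset_iff.2 fun y hy => (hin y hy).2)
        (card_image_of_injective _ σ.injective).ge
    have hσ : σ x ∉ W := by
      intro hσW
      have : σ x ∈ (U ∩ W).image σ := by
        rw [himg, mem_inter]
        exact ⟨perm_apply_mem_of_fixes_compl hU.1 hxU, hσW⟩
      obtain ⟨y, hy, hyx⟩ := mem_image.1 this
      rw [σ.injective hyx] at hy
      exact hx hy
    exact card_le_one.1 h _ (mem_sdiff.2 ⟨perm_apply_mem_of_fixes_compl hU.1 hxU, hσ⟩) _
      (mem_sdiff.2 ⟨hxU, hxW⟩)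
  · exact hU.1 x hxU

theorem followCount_eq_zero_of_ne [DecidableEq V] {U W : Finset V} {σ τ : Equiv.Perm V}
    (h : #(U \ W) ≤ 1) (h' : #(W \ U) ≤ 1) (hne : ¬ ((∀ x ∉ U ∩ W, σ x = x) ∧ τ = σ⁻¹)) :
    followCount T U σ W τ = 0 := by
  rw [followCount, Nat.card_eq_zero]
  refine Or.inl ⟨fun p => hne ?_⟩
  obtain ⟨h1, h2⟩ := p.2.2.1.fixes_compl_inter p.2.2.2 h
  obtain ⟨h3, -⟩ := p.2.2.2.fixes_compl_inter p.2.2.1 h'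
  refine ⟨h1, eq_inv_of_mul_eq_one_left (Equiv.ext fun x => ?_)⟩
  rw [Equiv.Perm.mul_apply, Equiv.Perm.one_apply]
  by_cases hx : x ∈ U ∩ W
  · exact h2 x hx
  · rw [h1 x hx, h3 x (by rwa [inter_comm])]

theorem Follows.conj [DecidableEq V] {U W : Finset V} {σ ρ : Equiv.Perm V}
    (h : ∀ x ∉ U ∩ W, σ x = x) (hρ : ∀ x ∉ U ∩ W, ρ x = x)
    {f g : T → V} (hU : Follows U σ f g) (hW : Follows W σ⁻¹ g f) :
    Follows U (ρ⁻¹ * σ) f (⇑ρ⁻¹ ∘ g) ∧ Follows W (ρ⁻¹ * σ)⁻¹ (⇑ρ⁻¹ ∘ g) f := by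
  have hi := perm_inv_apply_of_fixes_compl hρ
  have hW' : ∀ x ∈ W, ρ x ∈ W := fun x hx => perm_apply_mem_of_fixes_compl
    (fun y hy => hρ y fun hy' => hy (mem_inter.1 hy').2) hx
  refine ⟨⟨fun x hx => ?_, fun x hx => ?_⟩, fun x hx => ?_, fun x hx => ?_⟩
  · have hx' : x ∉ U ∩ W := fun hx' => hx (mem_inter.1 hx').1
    rw [Equiv.Perm.mul_apply, h x hx', hi x hx']
  · obtain ⟨t, ht, hgt⟩ := hU.2 x hx
    exact ⟨t, ht, by rw [comp_apply, hgt, Equiv.Perm.mul_apply]⟩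
  · have hx' : x ∉ U ∩ W := fun hx' => hx (mem_inter.1 hx').2
    rw [Equiv.Perm.inv_eq_iff_eq, Equiv.Perm.mul_apply, h x hx', hi x hx']
  · obtain ⟨t, ht, hgt⟩ := hW.2 (ρ x) (hW' x hx)
    refine ⟨t, fun s => ?_, ?_⟩
    · rw [← ht s, comp_apply, Equiv.Perm.inv_eq_iff_eq]
    · rw [hgt, mul_inv_rev, inv_inv, Equiv.Perm.mul_apply]

theorem followCount_inv [DecidableEq V] {U W : Finset V} {σ : Equiv.Perm V}
    (h : ∀ x ∉ U ∩ W, σ x = x) :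
    followCount T U σ W σ⁻¹ = followCount T U 1 W 1 := by
  refine Nat.card_congr
    { toFun := fun p => ⟨(p.1.1, ⇑σ⁻¹ ∘ p.1.2),
        ⟨p.2.1.1, (Equiv.surjective σ⁻¹).comp p.2.1.2⟩, ?_⟩
      invFun := fun p => ⟨(p.1.1, ⇑σ⁻¹⁻¹ ∘ p.1.2),
        ⟨p.2.1.1, (Equiv.surjective σ⁻¹⁻¹).comp p.2.1.2⟩, ?_⟩
      left_inv := fun p => by ext s <;> simp
      right_inv := fun p => by ext s <;> simp }
  · have := p.2.2.1.conj h h p.2.2.2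
    rwa [inv_mul_cancel, inv_one] at this
  · have := p.2.2.1.conj (fun x _ => rfl) (perm_inv_apply_of_fixes_compl h)
      (by rw [inv_one]; exact p.2.2.2)
    rwa [inv_inv, mul_one] at this

theorem card_perm_fixes_compl [Fintype V] [DecidableEq V] (J : Finset V) :
    #{σ : Equiv.Perm V | ∀ x ∉ J, σ x = x} = (#J).factorial := by
  have := Fintype.card_congr (Equiv.Perm.subtypeEquivSubtypePerm (· ∈ J))
  rw [Fintype.card_perm, Fintype.card_coe] at this
  rw [this, ← Fintype.card_subtype]

theorem sum_sign_sign_followCount [Fintype V] [DecidableEq V] {U W : Finset V}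
    (h : #(U \ W) ≤ 1) (h' : #(W \ U) ≤ 1) :
    ∑ σ : Equiv.Perm V, ∑ τ : Equiv.Perm V,
        (Equiv.Perm.sign σ : ℤ) * (Equiv.Perm.sign τ : ℤ) * (followCount T U σ W τ : ℤ) =
      (#(U ∩ W)).factorial * followCount T U 1 W 1 := by
  have : ∀ σ : Equiv.Perm V, ∑ τ : Equiv.Perm V,
      (Equiv.Perm.sign σ : ℤ) * (Equiv.Perm.sign τ : ℤ) * (followCount T U σ W τ : ℤ) =
      if ∀ x ∉ U ∩ W, σ x = x then (followCount T U 1 W 1 : ℤ) else 0 := by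
    intro σ
    rw [sum_eq_single σ⁻¹]
    · split_ifs with hσ
      · rw [followCount_inv hσ, Equiv.Perm.sign_inv, ← Units.val_mul, Int.units_mul_self]
        simp
      · rw [followCount_eq_zero_of_ne h h' fun hc => hσ hc.1]
        simp
    · intro τ _ hτ
      rw [followCount_eq_zero_of_ne h h' fun hc => hτ hc.2]
      simp
    · simp
  rw [sum_congr rfl fun σ _ => this σ, ← sum_filter, sum_const, card_perm_fixes_compl, nsmul_eq_mul]

theorem sum_sign_sign_followCount_eq_zero [Fintype V] [DecidableEq V] {U W : Finset V}
    (h : 1 < #(U \ W) ∨ 1 < #(W \ U)) :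
    ∑ σ : Equiv.Perm V, ∑ τ : Equiv.Perm V,
        (Equiv.Perm.sign σ : ℤ) * (Equiv.Perm.sign τ : ℤ) * (followCount T U σ W τ : ℤ) = 0 := by
  rcases h with h | h
  · rw [sum_comm]
    refine sum_eq_zero fun τ _ => ?_
    have := sum_sign_followCount_eq_zero (T := T) h τ
    calc _ = (Equiv.Perm.sign τ : ℤ) * ∑ σ : Equiv.Perm V,
          (Equiv.Perm.sign σ : ℤ) * (followCount T U σ W τ : ℤ) := by
            rw [mul_sum]; exact sum_congr rfl fun σ _ => by ring
      _ = 0 := by rw [this, mul_zero]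
  · refine sum_eq_zero fun σ _ => ?_
    have := sum_sign_followCount_eq_zero (T := T) h σ
    calc _ = (Equiv.Perm.sign σ : ℤ) * ∑ τ : Equiv.Perm V,
          (Equiv.Perm.sign τ : ℤ) * (followCount T W τ U σ : ℤ) := by
            rw [mul_sum]; exact sum_congr rfl fun τ _ => by rw [followCount_comm]; ring
      _ = 0 := by rw [this, mul_zero]

/-- Surjections for which the points `t x`, `x ∈ E`, are mapped to `x`, and are alone in their
fibre for `x ∈ U`. -/
theorem natCard_loops [Fintype V] [DecidableEq V] [Fintype T] {U E : Finset V} (hUE : U ⊆ E)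
    (hE : #(E \ U) ≤ 1) (t : E ↪ T) :
    (Fintype.card V - #U) ^ #(E \ U) *
      Nat.card {f : T → V // Surjective f ∧ ∀ x : E, f (t x) = x ∧
        (x.1 ∈ U → ∀ s, f s = x ↔ s = t x)} =
      surjCount (Fintype.card V - #U) (Fintype.card T - #U) := by
  set a : U ↪ V := ⟨Subtype.val, Subtype.val_injective⟩ with ha
  set t' : U ↪ T := ⟨fun x => t ⟨x.1, hUE x.2⟩, fun x y hxy => by
    have := t.injective hxy
    exact Subtype.ext (congrArg (fun z : E => z.1) this)⟩ with ht'
  rcases Nat.le_one_iff_eq_zero_or_eq_one.1 hE with h0 | h1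
  · have := natCard_surjective_pinned a t'
    rw [Fintype.card_coe] at this
    rw [h0, pow_zero, one_mul, ← this]
    refine Nat.card_congr (Equiv.subtypeEquivRight fun f => ?_)
    rw [card_eq_zero, sdiff_eq_empty_iff_subset] at h0
    refine and_congr_right fun _ => ⟨fun h x s => (h ⟨x.1, hUE x.2⟩).2 x.2 s, fun h x => ?_⟩
    have hx := h ⟨x.1, h0 x.2⟩
    exact ⟨(hx _).2 rfl, fun _ => hx⟩
  · obtain ⟨w, hw⟩ := card_eq_one.1 h1
    have hwm : w ∈ E \ U := by rw [hw]; exact mem_singleton_self w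
    rw [mem_sdiff] at hwm
    have := natCard_surjective_pinned_value a t' w
      (by rintro ⟨i, hi⟩; exact hwm.2 (by rw [← hi]; exact i.2)) (t ⟨w, hwm.1⟩) (by
        rintro ⟨i, hi⟩
        have := t.injective hi
        rw [Subtype.ext_iff] at this
        exact hwm.2 (by rw [← show i.1 = w from this]; exact i.2))
    rw [Fintype.card_coe] at this
    rw [h1, pow_one, ← this]
    congr 1
    refine Nat.card_congr (Equiv.subtypeEquivRight fun f => ?_)
    rw [and_assoc]
    refine and_congr_right fun _ => ⟨fun h => ⟨fun x s => (h ⟨x.1, hUE x.2⟩).2 x.2 s,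
      (h ⟨w, hwm.1⟩).1⟩, fun h x => ?_⟩
    by_cases hx : x.1 ∈ U
    · have hx' := h.1 ⟨x.1, hx⟩
      exact ⟨(hx' _).2 rfl, fun _ => hx'⟩
    · have : x.1 ∈ E \ U := mem_sdiff.2 ⟨x.2, hx⟩
      rw [hw, mem_singleton] at this
      obtain ⟨x, hxE⟩ := x
      obtain rfl : x = w := this
      exact ⟨h.2, fun h' => absurd h' hx⟩

theorem follows_one {U : Finset V} {f g : T → V} :
    Follows U 1 f g ↔ ∀ x ∈ U, SoleArc f g x x := by
  simp [Follows]

/-- The times `t x` of the loops `x → x`, `x ∈ U ∪ W`, form an embedding; once it is fixed, the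
conditions on `f` and on `g` are independent. -/
theorem followCount_one_eq_sum [Fintype V] [DecidableEq V] [Fintype T] (U W : Finset V) :
    followCount T U 1 W 1 = ∑ t : ↥(U ∪ W) ↪ T,
      Nat.card {f : T → V // Surjective f ∧ ∀ x : ↥(U ∪ W), f (t x) = x ∧
        (x.1 ∈ U → ∀ s, f s = x ↔ s = t x)} *
      Nat.card {g : T → V // Surjective g ∧ ∀ x : ↥(U ∪ W), g (t x) = x ∧
        (x.1 ∈ W → ∀ s, g s = x ↔ s = t x)} := by
  classical
  simp_rw [← Nat.card_prod]
  rw [← Nat.card_sigma, followCount]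
  symm
  refine Nat.card_congr (Equiv.ofBijective (fun z => ⟨(z.2.1.1, z.2.2.1),
    ⟨z.2.1.2.1, z.2.2.2.1⟩, ?_, ?_⟩) ⟨?_, ?_⟩)
  · rw [follows_one]
    exact fun x hx => ⟨z.1 ⟨x, mem_union_left _ hx⟩, (z.2.1.2.2 ⟨x, mem_union_left _ hx⟩).2 hx,
      (z.2.2.2.2 ⟨x, mem_union_left _ hx⟩).1⟩
  · rw [follows_one]
    exact fun x hx => ⟨z.1 ⟨x, mem_union_right _ hx⟩, (z.2.2.2.2 ⟨x, mem_union_right _ hx⟩).2 hx,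
      (z.2.1.2.2 ⟨x, mem_union_right _ hx⟩).1⟩
  · rintro ⟨t, ⟨f, hf⟩, ⟨g, hg⟩⟩ ⟨t', ⟨f', hf'⟩, ⟨g', hg'⟩⟩ h
    have h1 : (f, g) = (f', g') := congrArg Subtype.val h
    obtain ⟨rfl, rfl⟩ := Prod.mk.inj h1
    obtain rfl : t = t' := by
      ext x
      rcases mem_union.1 x.2 with hx | hx
      · exact ((hf'.2 x).2 hx _).1 (hf.2 x).1
      · exact ((hg'.2 x).2 hx _).1 (hg.2 x).1
    rfl
  · rintro ⟨⟨f, g⟩, ⟨hf, hg⟩, hU, hW⟩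
    rw [follows_one] at hU hW
    have hex : ∀ x : ↥(U ∪ W), ∃ t, f t = x ∧ g t = x ∧ (x.1 ∈ U → ∀ s, f s = x ↔ s = t) ∧
        (x.1 ∈ W → ∀ s, g s = x ↔ s = t) := by
      rintro ⟨x, hx⟩
      by_cases hxU : x ∈ U
      · obtain ⟨t, ht, hgt⟩ := hU x hxU
        refine ⟨t, (ht t).2 rfl, hgt, fun _ => ht, fun hxW => ?_⟩
        obtain ⟨t', ht', -⟩ := hW x hxW
        rw [(ht' t).1 hgt]
        exact ht'
      · have hxW : x ∈ W := (mem_union.1 hx).resolve_left hxU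
        obtain ⟨t, ht, hft⟩ := hW x hxW
        exact ⟨t, hft, (ht t).2 rfl, fun h => absurd h hxU, fun _ => ht⟩
    choose t h1 h2 h3 h4 using hex
    have ht : Injective t := fun x y hxy => Subtype.ext (by rw [← h1 x, ← h1 y, hxy])
    exact ⟨⟨⟨t, ht⟩, ⟨f, hf, fun x => ⟨h1 x, h3 x⟩⟩, ⟨g, hg, fun x => ⟨h2 x, h4 x⟩⟩⟩, rfl⟩

theorem followCount_one [Fintype V] [DecidableEq V] [Fintype T] {U W : Finset V}
    (h : #(U \ W) ≤ 1) (h' : #(W \ U) ≤ 1) :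
    (Fintype.card V - #U) ^ #(W \ U) * (Fintype.card V - #W) ^ #(U \ W) *
      followCount T U 1 W 1 = (Fintype.card T).descFactorial #(U ∪ W) *
        (surjCount (Fintype.card V - #U) (Fintype.card T - #U) *
          surjCount (Fintype.card V - #W) (Fintype.card T - #W)) := by
  classical
  have hU : (U ∪ W) \ U = W \ U := union_sdiff_left U W
  have hW : (U ∪ W) \ W = U \ W := union_sdiff_right U W
  rw [followCount_one_eq_sum, mul_sum]
  have : ∀ t : ↥(U ∪ W) ↪ T, (Fintype.card V - #U) ^ #(W \ U) *
      (Fintype.card V - #W) ^ #(U \ W) *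
      (Nat.card {f : T → V // Surjective f ∧ ∀ x : ↥(U ∪ W), f (t x) = x ∧
        (x.1 ∈ U → ∀ s, f s = x ↔ s = t x)} *
      Nat.card {g : T → V // Surjective g ∧ ∀ x : ↥(U ∪ W), g (t x) = x ∧
        (x.1 ∈ W → ∀ s, g s = x ↔ s = t x)}) =
      surjCount (Fintype.card V - #U) (Fintype.card T - #U) *
          surjCount (Fintype.card V - #W) (Fintype.card T - #W) := by
    intro t
    have h1 := natCard_loops subset_union_left (by rwa [hU]) t
    have h2 := natCard_loops subset_union_right (by rwa [hW]) t
    rw [hU] at h1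
    rw [hW] at h2
    rw [← h1, ← h2]
    ring
  rw [sum_congr rfl fun t _ => this t, sum_const, card_univ, Fintype.card_embedding_eq,
    Fintype.card_coe, smul_eq_mul]

end Evaluation

/-! ### The exact number of insertion sequences without simple sets -/

section ExactCount

open Finset Function

theorem sum_choose_mul_of_support_two (N : ℕ) (g : ℕ → ℝ) (hg : ∀ b, 1 < b → g b = 0) :
    ∑ b ∈ range (N + 1), (N.choose b : ℝ) * g b = g 0 + N * g 1 := by
  rcases N with _ | N
  · simp
  · rw [sum_range_succ', sum_range_succ', sum_eq_zero]
    · simp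
      ring
    · intro b _
      rw [hg _ (by omega), mul_zero]

theorem sum_inter_sdiff {V : Type*} [Fintype V] [DecidableEq V] (F : ℕ → ℕ → ℕ → ℝ)
    (U : Finset V) :
    ∑ W : Finset V, F #(U ∩ W) #(U \ W) #(W \ U) =
      ∑ a ∈ range (#U + 1), ((#U).choose a : ℝ) *
        ∑ b ∈ range (Fintype.card V - #U + 1), ((Fintype.card V - #U).choose b : ℝ) *
          F a (#U - a) b := by
  have h1 : ∑ W : Finset V, F #(U ∩ W) #(U \ W) #(W \ U) =
      ∑ A ∈ U.powerset, ∑ B ∈ Uᶜ.powerset, F #A (#U - #A) #B := by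
    rw [← sum_product']
    refine sum_nbij' (fun W => (U ∩ W, W \ U)) (fun p => p.1 ∪ p.2) ?_ ?_ ?_ ?_ ?_
    · intro W _
      simp only [mem_product, mem_powerset]
      exact ⟨inter_subset_left, fun x hx => mem_compl.2 (mem_sdiff.1 hx).2⟩
    · simp
    · intro W _
      ext x
      simp only [mem_union, mem_inter, mem_sdiff]
      tauto
    · rintro ⟨A, B⟩ hp
      simp only [mem_product, mem_powerset] at hp
      have hB : ∀ x ∈ B, x ∉ U := fun x hx => mem_compl.1 (hp.2 hx)
      ext x
      · simp only [mem_inter, mem_union]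
        exact ⟨fun h => h.2.resolve_right fun h' => hB x h' h.1, fun h => ⟨hp.1 h, Or.inl h⟩⟩
      · simp only [mem_sdiff, mem_union]
        exact ⟨fun h => h.1.resolve_left fun h' => h.2 (hp.1 h'), fun h => ⟨Or.inr h, hB x h⟩⟩
    · intro W _
      rw [card_sdiff, inter_comm]
  rw [h1]
  have h2 : ∀ A ∈ U.powerset, ∑ B ∈ Uᶜ.powerset, F #A (#U - #A) #B =
      ∑ b ∈ range (Fintype.card V - #U + 1), ((Fintype.card V - #U).choose b : ℝ) *
          F #A (#U - #A) b := by
    intro A _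
    rw [sum_powerset_apply_card (fun b => F #A (#U - #A) b), card_compl]
    simp only [nsmul_eq_mul]
  rw [sum_congr rfl h2, sum_powerset_apply_card (fun a =>
    ∑ b ∈ range (Fintype.card V - #U + 1), ((Fintype.card V - #U).choose b : ℝ) *
          F a (#U - a) b)]
  simp only [nsmul_eq_mul]

/-- Summation of a function of the sizes of `U ∩ W`, `U \ W` and `W \ U` over all pairs of sets for
which the two differences have at most one element. -/
theorem sum_sum_inter_sdiff {V : Type*} [Fintype V] [DecidableEq V] (F : ℕ → ℕ → ℕ → ℝ)
    (hk : ∀ j k l, 1 < k → F j k l = 0) (hl : ∀ j k l, 1 < l → F j k l = 0) (n : ℕ)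
    (hn : Fintype.card V = n) :
    ∑ U : Finset V, ∑ W : Finset V, F #(U ∩ W) #(U \ W) #(W \ U) =
      ∑ j ∈ range (n + 1), (n.choose j : ℝ) * (F j 0 0 + ((n - j : ℕ) : ℝ) * F j 0 1 +
        ((n - j : ℕ) : ℝ) * (F j 1 0 + ((n - j - 1 : ℕ) : ℝ) * F j 1 1)) := by
  have h1 : ∀ U : Finset V, ∑ W : Finset V, F #(U ∩ W) #(U \ W) #(W \ U) =
      (F #U 0 0 + ((n - #U : ℕ) : ℝ) * F #U 0 1) +
      #U * (F (#U - 1) 1 0 + ((n - #U : ℕ) : ℝ) * F (#U - 1) 1 1) := by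
    intro U
    have hH : ∀ a k, ∑ b ∈ range (n - #U + 1), ((n - #U).choose b : ℝ) * F a k b =
        F a k 0 + ((n - #U : ℕ) : ℝ) * F a k 1 := fun a k =>
      sum_choose_mul_of_support_two _ _ fun b hb => hl a k b hb
    rw [sum_inter_sdiff, hn]
    simp_rw [hH]
    rw [← sum_range_reflect]
    have hr : ∀ k ∈ range (#U + 1), ((#U).choose (#U + 1 - 1 - k) : ℝ) *
        (F (#U + 1 - 1 - k) (#U - (#U + 1 - 1 - k)) 0 +
          ((n - #U : ℕ) : ℝ) * F (#U + 1 - 1 - k) (#U - (#U + 1 - 1 - k)) 1) =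
        ((#U).choose k : ℝ) *
        (F (#U - k) k 0 + ((n - #U : ℕ) : ℝ) * F (#U - k) k 1) := by
      intro k hk'
      have hk' : k ≤ #U := Nat.lt_succ_iff.1 (mem_range.1 hk')
      rw [Nat.add_sub_cancel, Nat.choose_symm hk', Nat.sub_sub_self hk']
    rw [sum_congr rfl hr, sum_choose_mul_of_support_two _
      (fun k => F (#U - k) k 0 + ((n - #U : ℕ) : ℝ) * F (#U - k) k 1)
      fun k hk' => by simp [hk _ k _ hk']]
    simp
  rw [sum_congr rfl fun U _ => h1 U, ← powerset_univ, sum_powerset_apply_card (fun u =>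
    (F u 0 0 + ((n - u : ℕ) : ℝ) * F u 0 1) +
      u * (F (u - 1) 1 0 + ((n - u : ℕ) : ℝ) * F (u - 1) 1 1)), card_univ, hn]
  simp only [nsmul_eq_mul, mul_add, sum_add_distrib]
  have hshift : ∀ G : ℕ → ℕ → ℝ, ∑ u ∈ range (n + 1), (n.choose u : ℝ) * (u * G (u - 1) (n - u)) =
      ∑ j ∈ range (n + 1), (n.choose j : ℝ) * (((n - j : ℕ) : ℝ) * G j (n - j - 1)) := by
    intro G
    rw [sum_range_succ', sum_range_succ]
    simp only [Nat.cast_zero, zero_mul, mul_zero, add_zero, Nat.sub_self]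
    refine sum_congr rfl fun j hj => ?_
    have := Nat.choose_succ_right_eq n j
    have hc : (n.choose (j + 1) : ℝ) * ((j + 1 : ℕ) : ℝ) = n.choose j * ((n - j : ℕ) : ℝ) := by
      exact_mod_cast this
    rw [← mul_assoc, hc, Nat.add_sub_cancel, Nat.sub_sub, mul_assoc]
  have e1 := hshift fun j _ => F j 1 0
  have e2 := hshift fun j N => (N : ℝ) * F j 1 1
  rw [e1, e2]

/-- The exact count. In the bracket, the three summands come from the pairs `U`, `W` whose two
differences `U \ W`, `W \ U` have neither, one, or both of them a single vertex; `j` is `#(U ∩ W)`.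
-/
theorem natCard_no_soleClosed_eq {n m : ℕ} (h : n < m) :
    (Nat.card {p : (Fin m → Fin n) × (Fin m → Fin n) // (Surjective p.1 ∧ Surjective p.2) ∧
      ¬ HasSoleClosed p.1 p.2 ∧ ¬ HasSoleClosed p.2 p.1} : ℝ) =
    ∑ j ∈ range n, (n.descFactorial j : ℝ) *
      (m.descFactorial j * (surjCount (n - j) (m - j) : ℝ) ^ 2
        - 2 * m.descFactorial (j + 1) * (surjCount (n - j) (m - j) : ℝ) *
            surjCount (n - j - 1) (m - j - 1)
        + m.descFactorial (j + 2) * (((n - j : ℕ) : ℝ) / ((n - j - 1 : ℕ) : ℝ)) *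
            (surjCount (n - j - 1) (m - j - 1) : ℝ) ^ 2) := by
  set F : ℕ → ℕ → ℕ → ℝ := fun j k l => if k ≤ 1 ∧ l ≤ 1 then
    (-1) ^ (k + l) * j.factorial * (m.descFactorial (j + k + l) *
      (surjCount (n - (j + k)) (m - (j + k)) / ((n - (j + k) : ℕ) : ℝ) ^ l) *
      (surjCount (n - (j + l)) (m - (j + l)) / ((n - (j + l) : ℕ) : ℝ) ^ k)) else 0 with hF
  have hterm : ∀ U W : Finset (Fin n), (((-1 : ℤ) ^ (#U + #W) *
      ∑ σ : Equiv.Perm (Fin n), ∑ τ : Equiv.Perm (Fin n),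
        (Equiv.Perm.sign σ : ℤ) * (Equiv.Perm.sign τ : ℤ) *
          (followCount (Fin m) U σ W τ : ℤ) : ℤ) : ℝ) = F #(U ∩ W) #(U \ W) #(W \ U) := by
    intro U W
    by_cases hc : #(U \ W) ≤ 1 ∧ #(W \ U) ≤ 1
    · rw [sum_sign_sign_followCount hc.1 hc.2, hF]
      simp only [if_pos hc]
      have hU : #U = #(U ∩ W) + #(U \ W) := (card_inter_add_card_sdiff U W).symm
      have hW : #W = #(U ∩ W) + #(W \ U) := by
        rw [inter_comm]; exact (card_inter_add_card_sdiff W U).symm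
      have hUW : #(U ∪ W) = #(U ∩ W) + #(U \ W) + #(W \ U) := by
        have := card_union_add_card_inter U W
        omega
      have hcount := followCount_one (T := Fin m) hc.1 hc.2
      rw [Fintype.card_fin, Fintype.card_fin] at hcount
      have hpos : ∀ A B : Finset (Fin n), (((n - #A : ℕ) : ℝ) ^ #(B \ A)) ≠ 0 := by
        intro A B
        rcases (B \ A).eq_empty_or_nonempty with h0 | ⟨x, hx⟩
        · simp [h0]
        · have : #A < n := by
            have := card_lt_univ_of_notMem (mem_sdiff.1 hx).2
            rwa [Fintype.card_fin] at this
          exact pow_ne_zero _ (Nat.cast_ne_zero.2 (by omega))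
      have h1 := hpos U W
      have h2 := hpos W U
      have hcR : ((n - #U : ℕ) : ℝ) ^ #(W \ U) * ((n - #W : ℕ) : ℝ) ^ #(U \ W) *
          (followCount (Fin m) U 1 W 1 : ℝ) = (m.descFactorial #(U ∪ W) : ℝ) *
          ((surjCount (n - #U) (m - #U) : ℝ) * (surjCount (n - #W) (m - #W) : ℝ)) := by
        exact_mod_cast hcount
      have hfc : (followCount (Fin m) U 1 W 1 : ℝ) = (m.descFactorial #(U ∪ W) : ℝ) *
          ((surjCount (n - #U) (m - #U) : ℝ) / ((n - #U : ℕ) : ℝ) ^ #(W \ U)) *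
          ((surjCount (n - #W) (m - #W) : ℝ) / ((n - #W : ℕ) : ℝ) ^ #(U \ W)) := by
        field_simp
        linarith
      have hsign : (-1 : ℝ) ^ (#U + #W) = (-1) ^ (#(U \ W) + #(W \ U)) := by
        rw [hU, hW, show #(U ∩ W) + #(U \ W) + (#(U ∩ W) + #(W \ U)) =
          2 * #(U ∩ W) + (#(U \ W) + #(W \ U)) by ring, pow_add, pow_mul]
        simp
      push_cast
      rw [hfc, hsign, ← hUW, ← hU, ← hW]
      ring
    · rw [sum_sign_sign_followCount_eq_zero (by omega), hF]
      simp only [if_neg hc]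
      simp
  have hmain := natCard_no_soleClosed (V := Fin n) (T := Fin m)
  have hmainR := congrArg (fun z : ℤ => (z : ℝ)) hmain
  simp only [Int.cast_natCast] at hmainR
  rw [hmainR, Int.cast_sum]
  have : ∀ U : Finset (Fin n), (((∑ W : Finset (Fin n), (-1 : ℤ) ^ (#U + #W) *
      ∑ σ : Equiv.Perm (Fin n), ∑ τ : Equiv.Perm (Fin n),
        (Equiv.Perm.sign σ : ℤ) * (Equiv.Perm.sign τ : ℤ) *
          (followCount (Fin m) U σ W τ : ℤ)) : ℤ) : ℝ) =
      ∑ W : Finset (Fin n), F #(U ∩ W) #(U \ W) #(W \ U) := by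
    intro U
    rw [Int.cast_sum]
    exact sum_congr rfl fun W _ => hterm U W
  rw [sum_congr rfl fun U _ => this U, sum_sum_inter_sdiff F
    (fun j k l hk => if_neg (by omega)) (fun j k l hk => if_neg (by omega)) n (Fintype.card_fin n),
    sum_range_succ]
  have hz : ∀ r, 0 < r → surjCount 0 r = 0 := by
    intro r hr
    obtain ⟨s, rfl⟩ := Nat.exists_eq_succ_of_ne_zero hr.ne'
    exact surjCount_zero_succ s
  have hlast : (n.choose n : ℝ) * (F n 0 0 + ((n - n : ℕ) : ℝ) * F n 0 1 +
        ((n - n : ℕ) : ℝ) * (F n 1 0 + ((n - n - 1 : ℕ) : ℝ) * F n 1 1)) = 0 := by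
    simp [hF, hz (m - n) (by omega)]
  rw [hlast, add_zero]
  refine sum_congr rfl fun j hj => ?_
  have hj : j < n := mem_range.1 hj
  rw [Nat.descFactorial_eq_factorial_mul_choose]
  have hne : ((n - j : ℕ) : ℝ) ≠ 0 := Nat.cast_ne_zero.2 (by omega)
  simp only [hF, le_refl, zero_le, and_self, if_true, pow_zero, pow_one, add_zero, Nat.cast_mul,
    div_one, zero_add, Nat.sub_sub]
  rcases Nat.eq_zero_or_pos (n - (j + 1)) with h0 | h0
  · rw [h0, hz (m - (j + 1)) (by omega)]
    simp
    ring
  · have hne' : ((n - (j + 1) : ℕ) : ℝ) ≠ 0 := Nat.cast_ne_zero.2 (by omega)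
    field_simp
    ring_nf

end ExactCount

/-! ### Simple sets, cycles and the probability space -/

section SimpleSets

open Finset Function

theorem resultingMultiDigraph_swap {n m : ℕ} (s : Fin m → Fin n × Fin n) (i j : Fin n) :
    resultingMultiDigraph (Prod.swap ∘ s) i j = resultingMultiDigraph s j i := by
  unfold resultingMultiDigraph
  congr 1
  ext t
  simp only [mem_filter, mem_univ, true_and, comp_apply, Prod.swap_eq_iff_eq_swap, Prod.swap_prod_mk]

theorem sum_resultingMultiDigraph {n m : ℕ} (s : Fin m → Fin n × Fin n) (i : Fin n)
    (S : Finset (Fin n)) :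
    ∑ j ∈ S, resultingMultiDigraph s i j = #{t | (s t).1 = i ∧ (s t).2 ∈ S} := by
  rw [card_eq_sum_card_fiberwise (f := fun t => (s t).2) (t := S)
    (fun t ht => (mem_filter.1 ht).2.2)]
  refine sum_congr rfl fun j hj => ?_
  unfold resultingMultiDigraph
  congr 1
  ext t
  simp only [mem_filter, mem_univ, true_and, Prod.ext_iff]
  constructor
  · rintro ⟨h1, h2⟩; exact ⟨⟨h1, h2 ▸ hj⟩, h2⟩
  · rintro ⟨⟨h1, -⟩, h2⟩; exact ⟨h1, h2⟩

theorem isSimpleSinkSet_iff {n m : ℕ} (s : Fin m → Fin n × Fin n) (S : Finset (Fin n)) :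
    (resultingMultiDigraph s).IsSimpleSinkSet S ↔ S.Nonempty ∧ ∀ x ∈ S, ∃ y ∈ S,
      SoleArc (fun t => (s t).1) (fun t => (s t).2) x y := by
  unfold MultiDigraph.IsSimpleSinkSet
  refine and_congr_right fun _ => ⟨fun ⟨h1, h2⟩ x hx => ?_, fun h => ⟨fun x hx j hj => ?_, ?_⟩⟩
  · have := h2 x hx
    rw [sum_resultingMultiDigraph, card_eq_one] at this
    obtain ⟨t, ht⟩ := this
    have htm : t ∈ ({t | (s t).1 = x ∧ (s t).2 ∈ S} : Finset (Fin m)) := by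
      rw [ht]; exact mem_singleton_self t
    simp only [mem_filter, mem_univ, true_and] at htm
    refine ⟨(s t).2, htm.2, t, fun z => ⟨fun hz => ?_, ?_⟩, rfl⟩
    · have hzS : (s z).2 ∈ S := by
        by_contra hc
        have h0 := h1 x hx _ hc
        unfold resultingMultiDigraph at h0
        rw [card_eq_zero] at h0
        exact notMem_empty z (h0 ▸ mem_filter.2 ⟨mem_univ z, Prod.ext hz rfl⟩)
      have : z ∈ ({t | (s t).1 = x ∧ (s t).2 ∈ S} : Finset (Fin m)) :=
        mem_filter.2 ⟨mem_univ z, hz, hzS⟩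
      rw [ht] at this
      exact mem_singleton.1 this
    · rintro rfl
      exact htm.1
  · obtain ⟨y, hy, t, ht, rfl⟩ := h x hx
    unfold resultingMultiDigraph
    rw [card_eq_zero, filter_eq_empty_iff]
    intro z _ hz
    have := (ht z).1 (by simp only [hz])
    subst this
    simp only [hz] at hy
    exact hj hy
  · intro x hx
    obtain ⟨y, hy, t, ht, rfl⟩ := h x hx
    rw [sum_resultingMultiDigraph, card_eq_one]
    refine ⟨t, ?_⟩
    ext z
    simp only [mem_filter, mem_univ, true_and, mem_singleton]
    constructor
    · rintro ⟨h1, -⟩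
      exact (ht z).1 h1
    · rintro rfl
      exact ⟨(ht z).2 rfl, hy⟩

theorem noSimpleSets_iff {n m : ℕ} (s : Fin m → Fin n × Fin n) :
    (resultingMultiDigraph s).NoSimpleSets ↔
      ¬ HasSoleClosed (fun t => (s t).1) (fun t => (s t).2) ∧
      ¬ HasSoleClosed (fun t => (s t).2) (fun t => (s t).1) := by
  have hsource : ∀ S, (resultingMultiDigraph s).IsSimpleSourceSet S ↔
      (resultingMultiDigraph (Prod.swap ∘ s)).IsSimpleSinkSet S := by
    intro S
    unfold MultiDigraph.IsSimpleSourceSet MultiDigraph.IsSimpleSinkSet MultiDigraph.IsSourceSet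
      MultiDigraph.IsSinkSet
    simp_rw [resultingMultiDigraph_swap]
  unfold MultiDigraph.NoSimpleSets HasSoleClosed
  simp_rw [hsource, isSimpleSinkSet_iff, forall_and, not_exists]
  rfl

theorem exists_isDirectedCycle {V : Type} {μ : MultiDigraph V} {S : Finset V} (hS : S.Nonempty)
    (h : ∀ x ∈ S, ∃ y ∈ S, 0 < μ x y) :
    ∃ (k : ℕ) (c : Fin (k + 1) → V), μ.IsDirectedCycle c ∧ ∀ i, c i ∈ S := by
  choose nx hnx hμ using h
  let φ : S → S := fun x => ⟨nx x.1 x.2, hnx x.1 x.2⟩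
  obtain ⟨x₀, hx₀⟩ := hS
  obtain ⟨a, b, hab, heq⟩ := Finite.exists_ne_map_eq_of_infinite fun k : ℕ => φ^[k] ⟨x₀, hx₀⟩
  wlog hlt : a < b generalizing a b
  · exact this b a hab.symm heq.symm (by omega)
  set y := φ^[a] ⟨x₀, hx₀⟩ with hy
  have hper : IsPeriodicPt φ (b - a) y := by
    unfold IsPeriodicPt IsFixedPt
    rw [hy, ← iterate_add_apply, Nat.sub_add_cancel hlt.le]
    exact heq.symm
  have hpos : 0 < minimalPeriod φ y := hper.minimalPeriod_pos (by omega)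
  obtain ⟨k, hk⟩ := Nat.exists_eq_succ_of_ne_zero hpos.ne'
  refine ⟨k, fun i => (φ^[i.1] y).1, ⟨fun i j hij => ?_, fun i => ?_⟩, fun i => (φ^[i.1] y).2⟩
  · have := iterate_injOn_Iio_minimalPeriod (f := φ) (x := y)
    have hij' := this (by have := i.2; simp [hk]; omega) (by have := j.2; simp [hk]; omega) (Subtype.ext hij)
    exact Fin.ext hij'
  · have hstep : φ^[(i + 1).1] y = φ (φ^[i.1] y) := by
      rw [← iterate_succ_apply' φ i.1 y]
      rcases Fin.eq_castSucc_or_eq_last i with ⟨j, rfl⟩ | rfl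
      · simp
      · rw [Fin.last_add_one, Fin.val_zero, Fin.val_last, ← hk]
        exact (iterate_minimalPeriod (f := φ) (x := y)).symm
    simp only [hstep]
    exact hμ _ _

theorem MultiDigraph.IsDirectedCycle.reverse {V : Type} {μ : MultiDigraph V} {k : ℕ}
    {c : Fin (k + 1) → V} (h : MultiDigraph.IsDirectedCycle (fun i j => μ j i) c) :
    μ.IsDirectedCycle fun i => c (-i) := by
  refine ⟨fun i j hij => neg_injective (h.1 hij), fun i => ?_⟩
  have := h.2 (-(i + 1))
  simpa using this

theorem X_eq_zero_iff {V : Type} [Fintype V] (μ : MultiDigraph V) :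
    μ.X = 0 ↔ μ.NoSimpleSets := by
  unfold MultiDigraph.X
  rw [Set.ncard_eq_zero (Set.toFinite _)]
  constructor
  · intro h S
    by_contra hc
    have hS : μ.IsSimpleSinkSet S ∨ μ.IsSimpleSourceSet S := by tauto
    obtain ⟨k, c, hc, hcS⟩ : ∃ (k : ℕ) (c : Fin (k + 1) → V),
        μ.IsDirectedCycle c ∧ ∀ i, c i ∈ S := by
      rcases hS with hS | hS
      · refine exists_isDirectedCycle hS.1 fun x hx => ?_
        have : ∑ j ∈ S, μ x j ≠ 0 := by rw [hS.2.2 x hx]; exact one_ne_zero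
        obtain ⟨y, hy, hxy⟩ := exists_ne_zero_of_sum_ne_zero this
        exact ⟨y, hy, Nat.pos_of_ne_zero hxy⟩
      · obtain ⟨k, c, hc, hcS⟩ := exists_isDirectedCycle (μ := fun i j => μ j i) hS.1
          fun x hx => by
            have : ∑ j ∈ S, μ j x ≠ 0 := by rw [hS.2.2 x hx]; exact one_ne_zero
            obtain ⟨y, hy, hxy⟩ := exists_ne_zero_of_sum_ne_zero this
            exact ⟨y, hy, Nat.pos_of_ne_zero hxy⟩
        exact ⟨k, _, hc.reverse, fun i => hcS _⟩
    have : c 0 ∈ μ.simpleCycleVertices := ⟨S, hS, k, c, hc, hcS, 0, rfl⟩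
    rw [h] at this
    exact this
  · intro h
    rw [Set.eq_empty_iff_forall_notMem]
    rintro v ⟨S, hS, -⟩
    exact hS.elim (h S).1 (h S).2

theorem mem_insertionSeqs {n m : ℕ} (s : Fin m → Fin n × Fin n) :
    s ∈ insertionSeqs n m ↔ Surjective (fun t => (s t).1) ∧ Surjective (fun t => (s t).2) := by
  have hout : ∀ s : Fin m → Fin n × Fin n, ∀ i,
      0 < (resultingMultiDigraph s).outDeg i ↔ ∃ t, (s t).1 = i := by
    intro s i
    unfold MultiDigraph.outDeg
    rw [sum_resultingMultiDigraph, card_pos]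
    simp [Finset.Nonempty]
  have hin : ∀ i, 0 < (resultingMultiDigraph s).inDeg i ↔ ∃ t, (s t).2 = i := by
    intro i
    have := hout (Prod.swap ∘ s) i
    unfold MultiDigraph.outDeg at this
    simp_rw [resultingMultiDigraph_swap] at this
    exact this
  unfold insertionSeqs
  simp only [mem_filter, mem_univ, true_and, hout, hin, forall_and]
  rfl

theorem card_insertionSeqs (n m : ℕ) : #(insertionSeqs n m) = surjCount n m ^ 2 := by
  rw [sq, surjCount, ← Nat.card_prod, ← Nat.card_congr Equiv.subtypeProdEquivProd,
    ← Fintype.card_coe, ← Nat.card_eq_fintype_card]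
  refine Nat.card_congr (Equiv.subtypeEquiv
    (Equiv.arrowProdEquivProdArrow (Fin m) (fun _ => Fin n) (fun _ => Fin n)) fun s => ?_)
  rw [mem_insertionSeqs]
  rfl

/-- A random insertion sequence is a pair of independent uniformly random surjections. -/
theorem probMG_eq (n m : ℕ) : probMG n m (fun μ => μ.X = 0) =
    (Nat.card {p : (Fin m → Fin n) × (Fin m → Fin n) // (Surjective p.1 ∧ Surjective p.2) ∧
      ¬ HasSoleClosed p.1 p.2 ∧ ¬ HasSoleClosed p.2 p.1} : ℝ) / (surjCount n m : ℝ) ^ 2 := by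
  classical
  unfold probMG
  rw [card_insertionSeqs]
  push_cast
  congr 2
  rw [← Fintype.card_coe, ← Nat.card_eq_fintype_card]
  refine Nat.card_congr (Equiv.subtypeEquiv
    (Equiv.arrowProdEquivProdArrow (Fin m) (fun _ => Fin n) (fun _ => Fin n)) fun s => ?_)
  rw [mem_filter, mem_insertionSeqs, X_eq_zero_iff, noSimpleSets_iff]
  rfl

end SimpleSets

/-! ### Ratios of surjection numbers -/

section Ratios

open Finset PowerSeries

/-- The power series `(e ^ X - 1) / X`. -/
noncomputable def expQuot : PowerSeries ℝ := PowerSeries.mk fun k => 1 / ((k + 1).factorial : ℝ)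

/-- The coefficient of `X ^ r` in `((e ^ X - 1) / X) ^ n`. -/
noncomputable def expQuotCoeff (n r : ℕ) : ℝ := coeff r (expQuot ^ n)

theorem expQuotCoeff_succ (n r : ℕ) : expQuotCoeff (n + 1) r =
    ∑ k ∈ range (r + 1), 1 / ((k + 1).factorial : ℝ) * expQuotCoeff n (r - k) := by
  unfold expQuotCoeff
  rw [pow_succ', coeff_mul, Nat.sum_antidiagonal_eq_sum_range_succ_mk]
  refine sum_congr rfl fun k _ => ?_
  rw [expQuot, coeff_mk]

theorem expQuotCoeff_zero_right (n : ℕ) : expQuotCoeff n 0 = 1 := by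
  unfold expQuotCoeff
  rw [coeff_zero_eq_constantCoeff_apply, map_pow, ← coeff_zero_eq_constantCoeff_apply, expQuot,
    coeff_mk]
  simp

theorem expQuotCoeff_zero_succ (r : ℕ) : expQuotCoeff 0 (r + 1) = 0 := by
  unfold expQuotCoeff
  rw [pow_zero, coeff_one, if_neg (Nat.succ_ne_zero r)]

theorem expQuotCoeff_nonneg (n r : ℕ) : 0 ≤ expQuotCoeff n r := by
  induction n generalizing r with
  | zero =>
    rcases r with _ | r
    · rw [expQuotCoeff_zero_right]; exact zero_le_one
    · rw [expQuotCoeff_zero_succ]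
  | succ n ih =>
    rw [expQuotCoeff_succ]
    exact sum_nonneg fun k _ => mul_nonneg (by positivity) (ih _)

theorem expQuotCoeff_pos {n : ℕ} (hn : 0 < n) (r : ℕ) : 0 < expQuotCoeff n r := by
  obtain ⟨n, rfl⟩ := Nat.exists_eq_succ_of_ne_zero hn.ne'
  rw [Nat.succ_eq_add_one, expQuotCoeff_succ]
  refine sum_pos' (fun k _ => mul_nonneg (by positivity) (expQuotCoeff_nonneg _ _))
    ⟨r, self_mem_range_succ r, ?_⟩
  rw [Nat.sub_self, expQuotCoeff_zero_right]
  positivity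

/-- The differential equation `X E' = 1 + X E - E` of `E = (e ^ X - 1) / X`, read off from the
coefficients of `E ^ (n + 1)`. -/
theorem expQuotCoeff_rec (n r : ℕ) :
    ((n : ℝ) + 1 + (r + 1)) * expQuotCoeff (n + 1) (r + 1) =
      (n + 1) * (expQuotCoeff (n + 1) r + expQuotCoeff n (r + 1)) := by
  have hode : (X : PowerSeries ℝ) * derivative ℝ expQuot = 1 + X * expQuot - expQuot := by
    ext k
    rcases k with _ | k
    · simp [expQuot]
    · rw [coeff_succ_X_mul, coeff_derivative, map_sub, map_add, coeff_succ_X_mul, coeff_one,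
        if_neg (Nat.succ_ne_zero k), expQuot, coeff_mk, coeff_mk, Nat.factorial_succ (k + 1)]
      push_cast
      have : ((k + 1).factorial : ℝ) ≠ 0 := by positivity
      have : (k : ℝ) + 1 + 1 ≠ 0 := by positivity
      field_simp
      ring
  have hder : (X : PowerSeries ℝ) * derivative ℝ (expQuot ^ (n + 1)) =
      ((n + 1 : ℕ) : PowerSeries ℝ) * (expQuot ^ n + X * expQuot ^ (n + 1) - expQuot ^ (n + 1)) := by
    rw [derivative_pow, Nat.add_sub_cancel]
    calc _ = ((n + 1 : ℕ) : PowerSeries ℝ) * expQuot ^ n * (X * derivative ℝ expQuot) := by ring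
      _ = _ := by rw [hode]; ring
  have h := congrArg (coeff (r + 1)) hder
  rw [coeff_succ_X_mul, coeff_derivative, ← map_natCast (C (R := ℝ)), coeff_C_mul, map_sub, map_add,
    coeff_succ_X_mul] at h
  unfold expQuotCoeff
  push_cast at h
  linarith

theorem surjCount_eq (n r : ℕ) :
    (surjCount n (n + r) : ℝ) = (n + r).factorial * expQuotCoeff n r := by
  induction n generalizing r with
  | zero =>
    rcases r with _ | r
    · rw [expQuotCoeff_zero_right, surjCount_zero_zero]; simp
    · rw [expQuotCoeff_zero_succ, Nat.zero_add, surjCount_zero_succ]; simp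
  | succ n ih =>
    induction r with
    | zero =>
      rw [expQuotCoeff_zero_right, add_zero, surjCount_succ_succ, surjCount_eq_zero_of_lt (by omega),
        Nat.factorial_succ]
      have := ih 0
      rw [expQuotCoeff_zero_right, add_zero] at this
      push_cast
      rw [this]
      ring
    | succ r ihr =>
      have h := expQuotCoeff_rec n r
      have h1 := ih (r + 1)
      rw [show n + 1 + (r + 1) = (n + (r + 1)) + 1 by ring, surjCount_succ_succ, Nat.factorial_succ]
      rw [show n + 1 + r = n + (r + 1) by ring] at ihr
      push_cast
      rw [ihr, h1]
      have h2 : ((n : ℝ) + (r + 1) + 1) = n + 1 + (r + 1) := by ring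
      rw [h2, mul_right_comm, h]
      ring

/-- The probability that a given point has a one-point fibre under a random surjection of an
`(n + r)`-element set onto an `n`-element set. -/
noncomputable def loneProb (n r : ℕ) : ℝ := expQuotCoeff (n - 1) r / expQuotCoeff n r

/-- The ratio of consecutive coefficients of `((e ^ X - 1) / X) ^ n`; it approximates the Poisson
parameter `λ`. -/
noncomputable def coeffRatio (n r : ℕ) : ℝ :=
  if r = 0 then 0 else expQuotCoeff n (r - 1) / expQuotCoeff n r

theorem loneProb_zero_right (n : ℕ) : loneProb n 0 = 1 := by
  rw [loneProb, expQuotCoeff_zero_right, expQuotCoeff_zero_right, div_one]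

theorem loneProb_one_succ (r : ℕ) : loneProb 1 (r + 1) = 0 := by
  rw [loneProb, Nat.sub_self, expQuotCoeff_zero_succ, zero_div]

theorem loneProb_nonneg (n r : ℕ) : 0 ≤ loneProb n r :=
  div_nonneg (expQuotCoeff_nonneg _ _) (expQuotCoeff_nonneg _ _)

theorem loneProb_pos {n : ℕ} (hn : 2 ≤ n) (r : ℕ) : 0 < loneProb n r :=
  div_pos (expQuotCoeff_pos (by omega) _) (expQuotCoeff_pos (by omega) _)

theorem coeffRatio_zero_right (n : ℕ) : coeffRatio n 0 = 0 := if_pos rfl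

theorem coeffRatio_succ (n r : ℕ) :
    coeffRatio n (r + 1) = expQuotCoeff n r / expQuotCoeff n (r + 1) := by
  rw [coeffRatio, if_neg (Nat.succ_ne_zero r), Nat.add_sub_cancel]

theorem coeffRatio_nonneg (n r : ℕ) : 0 ≤ coeffRatio n r := by
  unfold coeffRatio
  split_ifs
  · exact le_rfl
  · exact div_nonneg (expQuotCoeff_nonneg _ _) (expQuotCoeff_nonneg _ _)

theorem loneProb_add_coeffRatio {n : ℕ} (hn : 1 ≤ n) (r : ℕ) :
    loneProb n r + coeffRatio n r = 1 + (r : ℝ) / n := by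
  obtain ⟨n, rfl⟩ := Nat.exists_eq_add_of_le' hn
  rcases r with _ | r
  · simp [loneProb_zero_right, coeffRatio_zero_right]
  · have h := expQuotCoeff_rec n r
    have hpos := expQuotCoeff_pos (Nat.succ_pos n) (r + 1)
    rw [Nat.succ_eq_add_one] at hpos
    rw [coeffRatio_succ, loneProb, Nat.add_sub_cancel]
    have : (n : ℝ) + 1 ≠ 0 := by positivity
    push_cast
    field_simp
    linarith

theorem coeffRatio_mul_loneProb {n : ℕ} (hn : 1 ≤ n) (r : ℕ) :
    coeffRatio n (r + 1) * loneProb (n + 1) (r + 1) =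
      loneProb (n + 1) r * coeffRatio (n + 1) (r + 1) := by
  have h1 := expQuotCoeff_pos hn r
  have h2 := expQuotCoeff_pos hn (r + 1)
  have h3 := expQuotCoeff_pos (Nat.succ_pos n) r
  have h4 := expQuotCoeff_pos (Nat.succ_pos n) (r + 1)
  rw [Nat.succ_eq_add_one] at h3 h4
  rw [coeffRatio_succ, coeffRatio_succ, loneProb, loneProb, Nat.add_sub_cancel]
  field_simp

theorem loneProb_mul {n : ℕ} (hn : 1 ≤ n) (r : ℕ) :
    loneProb (n + 1) (r + 1) * (loneProb (n + 1) r + coeffRatio n (r + 1)) =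
      loneProb (n + 1) r * (1 + ((r : ℝ) + 1) / (n + 1)) := by
  have h1 := coeffRatio_mul_loneProb hn r
  have h2 := loneProb_add_coeffRatio (Nat.succ_le_succ (Nat.zero_le n)) (r + 1)
  push_cast at h2
  rw [← h2]
  linarith

theorem coeffRatio_succ_le_of_loneProb_le {n : ℕ} (hn : 1 ≤ n) {r : ℕ}
    (h : loneProb (n + 1) (r + 1) ≤ loneProb (n + 1) r) :
    coeffRatio (n + 1) (r + 1) ≤ coeffRatio n (r + 1) := by
  have h1 := coeffRatio_mul_loneProb hn r
  have h2 := loneProb_pos (show 2 ≤ n + 1 by omega) r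
  have h3 := mul_le_mul_of_nonneg_left h (coeffRatio_nonneg n (r + 1))
  rw [h1, mul_comm] at h3
  exact le_of_mul_le_mul_right h3 h2

/-- A point is less likely to have a one-point fibre if there are more points in the source. -/
theorem loneProb_succ_right_le {n : ℕ} (hn : 1 ≤ n) (r : ℕ) :
    loneProb n (r + 1) ≤ loneProb n r := by
  induction n, hn using Nat.le_induction generalizing r with
  | base => rw [loneProb_one_succ]; exact loneProb_nonneg 1 r
  | succ n hn ih =>
    induction r with
    | zero =>
      have h3 := loneProb_add_coeffRatio hn 1
      have h4 := ih 0
      have h5 := loneProb_mul hn 0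
      rw [loneProb_zero_right] at h4 h5 ⊢
      have hn' : (1 : ℝ) ≤ n := by exact_mod_cast hn
      have hle : (1 : ℝ) / (n + 1) ≤ 1 / n := by
        apply one_div_le_one_div_of_le <;> linarith
      push_cast at h3 h5
      simp only [zero_add] at h4 h5 h3 ⊢
      have hc : (1 : ℝ) + 1 / (n + 1) ≤ 1 + coeffRatio n 1 := by linarith
      have hp := coeffRatio_nonneg n 1
      by_contra hcon
      push Not at hcon
      nlinarith
    | succ r ihr =>
      have hv := coeffRatio_succ_le_of_loneProb_le hn ihr
      have h2 := loneProb_add_coeffRatio (show 1 ≤ n + 1 by omega) (r + 1)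
      have h3 := loneProb_add_coeffRatio hn (r + 1)
      have h3' := loneProb_add_coeffRatio hn (r + 2)
      have h4 := ih (r + 1)
      have h5 := loneProb_mul hn (r + 1)
      have hn' : (1 : ℝ) ≤ n := by exact_mod_cast hn
      have hle : (1 : ℝ) / (n + 1) ≤ 1 / n := by
        apply one_div_le_one_div_of_le <;> linarith
      have hU := loneProb_pos (show 2 ≤ n + 1 by omega) (r + 1)
      have hw := coeffRatio_nonneg n (r + 1 + 1)
      push_cast at h2 h3 h3' h5
      have e1 : ((r : ℝ) + 2) / n = (r + 1) / n + 1 / n := by ring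
      have e2 : ((r : ℝ) + 1 + 1) / (n + 1) = (r + 1) / (n + 1) + 1 / (n + 1) := by ring
      rw [e1] at h3'
      rw [e2] at h5
      have hs : 1 + (((r : ℝ) + 1) / (n + 1) + 1 / (n + 1)) ≤
          loneProb (n + 1) (r + 1) + coeffRatio n (r + 1 + 1) := by
        linarith
      have hmul := mul_le_mul_of_nonneg_left hs hU.le
      rw [← h5] at hmul
      exact le_of_mul_le_mul_right hmul (by linarith)

theorem loneProb_le_one {n : ℕ} (hn : 1 ≤ n) (r : ℕ) : loneProb n r ≤ 1 := by
  induction r with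
  | zero => rw [loneProb_zero_right]
  | succ r ih => exact (loneProb_succ_right_le hn r).trans ih

theorem coeffRatio_succ_left_le {n : ℕ} (hn : 1 ≤ n) (r : ℕ) :
    coeffRatio (n + 1) r ≤ coeffRatio n r := by
  rcases r with _ | r
  · rw [coeffRatio_zero_right, coeffRatio_zero_right]
  · exact coeffRatio_succ_le_of_loneProb_le hn (loneProb_succ_right_le (by omega) r)

/-- Given the first bound for `n`, the two bounds below follow from each other along `r`. -/
theorem loneProb_bounds_step {n : ℕ} (hn : 1 ≤ n)
    (h : ∀ r, ((n : ℝ) - 1) * loneProb n r ≤ n * loneProb n (r + 1)) (r : ℕ) :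
    ((n : ℝ) + 1) * loneProb (n + 1) r ≤ n * loneProb n r + 1 ∧
      (n : ℝ) * loneProb (n + 1) r ≤ (n + 1) * loneProb (n + 1) (r + 1) := by
  have hn' : (1 : ℝ) ≤ n := by exact_mod_cast hn
  have hstep : ∀ r, ((n : ℝ) + 1) * loneProb (n + 1) r ≤ n * loneProb n r + 1 →
      (n : ℝ) * loneProb (n + 1) r ≤ (n + 1) * loneProb (n + 1) (r + 1) := by
    intro r hr
    have hU := loneProb_pos (show 2 ≤ n + 1 by omega) r
    have hw := coeffRatio_nonneg n (r + 1)
    have h1 := loneProb_le_one hn r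
    have h2 := h r
    have h3 := loneProb_mul hn r
    have h4 := loneProb_add_coeffRatio hn (r + 1)
    push_cast at h4
    have h5 : (n : ℝ) * loneProb n (r + 1) + n * coeffRatio n (r + 1) = n + (r + 1) := by
      rw [← mul_add, h4]
      field_simp
    have h6 : (n : ℝ) * loneProb (n + 1) r ≤ 1 + n * loneProb n (r + 1) := by
      have : ((n : ℝ) + 1) * (n * loneProb (n + 1) r) ≤
          (n + 1) * (1 + n * loneProb n (r + 1)) := by nlinarith
      exact le_of_mul_le_mul_left this (by linarith)
    have h7 : ((n : ℝ) + 1) * (loneProb (n + 1) r * (1 + ((r : ℝ) + 1) / (n + 1))) =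
        loneProb (n + 1) r * (n + 1 + (r + 1)) := by
      field_simp
    have h8 : (n : ℝ) * loneProb (n + 1) r * (loneProb (n + 1) r + coeffRatio n (r + 1)) ≤
        (n + 1) * loneProb (n + 1) (r + 1) * (loneProb (n + 1) r + coeffRatio n (r + 1)) := by
      rw [mul_assoc ((n : ℝ) + 1), h3, h7, mul_comm (n : ℝ), mul_assoc]
      refine mul_le_mul_of_nonneg_left ?_ hU.le
      rw [mul_add]
      linarith
    exact le_of_mul_le_mul_right h8 (by linarith)
  suffices hcs : ((n : ℝ) + 1) * loneProb (n + 1) r ≤ n * loneProb n r + 1 from ⟨hcs, hstep r hcs⟩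
  induction r with
  | zero => simp [loneProb_zero_right]
  | succ r ih =>
    have hL := hstep r ih
    have hU := loneProb_pos (show 2 ≤ n + 1 by omega) r
    have hw := coeffRatio_nonneg n (r + 1)
    have h1 := coeffRatio_mul_loneProb hn r
    have h2 : (n : ℝ) * coeffRatio n (r + 1) ≤ (n + 1) * coeffRatio (n + 1) (r + 1) := by
      have := mul_le_mul_of_nonneg_left hL hw
      have h3 : (n : ℝ) * coeffRatio n (r + 1) * loneProb (n + 1) r ≤
          (n + 1) * coeffRatio (n + 1) (r + 1) * loneProb (n + 1) r := by
        linear_combination this + ((n : ℝ) + 1) * h1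
      exact le_of_mul_le_mul_right h3 hU
    have h4 := loneProb_add_coeffRatio hn (r + 1)
    have h5 := loneProb_add_coeffRatio (show 1 ≤ n + 1 by omega) (r + 1)
    push_cast at h4 h5
    have h6 : (n : ℝ) * loneProb n (r + 1) + n * coeffRatio n (r + 1) = n + (r + 1) := by
      rw [← mul_add, h4]
      field_simp
    have h7 : ((n : ℝ) + 1) * loneProb (n + 1) (r + 1) + (n + 1) * coeffRatio (n + 1) (r + 1) =
        n + 1 + (r + 1) := by
      rw [← mul_add, h5]
      field_simp
    linarith

theorem sub_one_mul_loneProb_le {n : ℕ} (hn : 1 ≤ n) (r : ℕ) :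
    ((n : ℝ) - 1) * loneProb n r ≤ n * loneProb n (r + 1) := by
  induction n, hn using Nat.le_induction generalizing r with
  | base => simpa using loneProb_nonneg 1 (r + 1)
  | succ n hn ih =>
    have := (loneProb_bounds_step hn ih r).2
    push_cast
    rwa [add_sub_cancel_right]

/-- Equivalently, the number of one-point fibres of a random surjection has nonnegative variance. -/
theorem succ_mul_loneProb_le {n : ℕ} (hn : 1 ≤ n) (r : ℕ) :
    ((n : ℝ) + 1) * loneProb (n + 1) r ≤ n * loneProb n r + 1 :=
  (loneProb_bounds_step hn (sub_one_mul_loneProb_le hn) r).1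

theorem coeffRatio_le_succ_mul {n : ℕ} (hn : 1 ≤ n) (r : ℕ) :
    (n : ℝ) * coeffRatio n r ≤ (n + 1) * coeffRatio (n + 1) r := by
  have hn' : (1 : ℝ) ≤ n := by exact_mod_cast hn
  have h4 := loneProb_add_coeffRatio hn r
  have h5 := loneProb_add_coeffRatio (show 1 ≤ n + 1 by omega) r
  have h := succ_mul_loneProb_le hn r
  push_cast at h4 h5
  have h6 : (n : ℝ) * loneProb n r + n * coeffRatio n r = n + r := by
    rw [← mul_add, h4]
    field_simp
  have h7 : ((n : ℝ) + 1) * loneProb (n + 1) r + (n + 1) * coeffRatio (n + 1) r = n + 1 + r := by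
    rw [← mul_add, h5]
    field_simp
  linarith

theorem coeffRatio_le_succ_right {n : ℕ} (hn : 1 ≤ n) (r : ℕ) :
    coeffRatio n r ≤ coeffRatio n (r + 1) := by
  have hn' : (1 : ℝ) ≤ n := by exact_mod_cast hn
  have h4 := loneProb_add_coeffRatio hn r
  have h5 := loneProb_add_coeffRatio hn (r + 1)
  have h := loneProb_succ_right_le hn r
  push_cast at h5
  have : ((r : ℝ) + 1) / n = r / n + 1 / n := by ring
  have : (0 : ℝ) ≤ 1 / n := by positivity
  linarith

theorem coeffRatio_succ_right_le {n : ℕ} (hn : 1 ≤ n) (r : ℕ) :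
    coeffRatio n (r + 1) ≤ coeffRatio n r + 2 / n := by
  have hn' : (1 : ℝ) ≤ n := by exact_mod_cast hn
  have h4 := loneProb_add_coeffRatio hn r
  have h5 := loneProb_add_coeffRatio hn (r + 1)
  have h := sub_one_mul_loneProb_le hn r
  have h1 := loneProb_le_one hn r
  push_cast at h5
  have e : ((r : ℝ) + 1) / n = r / n + 1 / n := by ring
  have h6 : loneProb n r - loneProb n (r + 1) ≤ 1 / n := by
    rw [le_div_iff₀ (by linarith)]
    nlinarith
  have e2 : (2 : ℝ) / n = 1 / n + 1 / n := by ring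
  linarith

theorem coeffRatio_le {n : ℕ} (hn : 1 ≤ n) (r : ℕ) : coeffRatio n r ≤ 2 * r / n := by
  induction r with
  | zero => simp [coeffRatio_zero_right]
  | succ r ih =>
    have := coeffRatio_succ_right_le hn r
    push_cast
    rw [mul_add, add_div]
    linarith

theorem coeffRatio_sub_le {n : ℕ} (hn : 1 ≤ n) (r i : ℕ) :
    coeffRatio n r - 2 * i / n ≤ coeffRatio n (r - i) := by
  induction i with
  | zero => simp
  | succ i ih =>
    have hn' : (1 : ℝ) ≤ n := by exact_mod_cast hn
    have e : 2 * ((i + 1 : ℕ) : ℝ) / n = 2 * i / n + 2 / n := by push_cast; ring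
    rw [e]
    rcases Nat.lt_or_ge i r with h | h
    · have := coeffRatio_succ_right_le hn (r - (i + 1))
      rw [show r - (i + 1) + 1 = r - i by omega] at this
      linarith
    · rw [show r - (i + 1) = r - i by omega]
      have : (0 : ℝ) ≤ 2 / n := by positivity
      linarith

theorem coeffRatio_mono_right {n : ℕ} (hn : 1 ≤ n) : Monotone (coeffRatio n) :=
  monotone_nat_of_le_succ (coeffRatio_le_succ_right hn)

theorem expQuotCoeff_sub {n : ℕ} (hn : 1 ≤ n) {r k : ℕ} (hk : k ≤ r) :
    expQuotCoeff n (r - k) / expQuotCoeff n r = ∏ i ∈ range k, coeffRatio n (r - i) := by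
  induction k with
  | zero => simp [(expQuotCoeff_pos hn r).ne']
  | succ k ih =>
    rw [prod_range_succ, ← ih (by omega), show r - k = r - (k + 1) + 1 by omega, coeffRatio_succ]
    have h1 := expQuotCoeff_pos hn r
    have h2 := expQuotCoeff_pos hn (r - (k + 1) + 1)
    field_simp

/-- The fibre over the last point has `k + 1` elements for some `k ≤ r`. -/
theorem inv_loneProb {n : ℕ} (hn : 1 ≤ n) (r : ℕ) : (loneProb (n + 1) r)⁻¹ =
    ∑ k ∈ range (r + 1), 1 / ((k + 1).factorial : ℝ) * ∏ i ∈ range k, coeffRatio n (r - i) := by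
  rw [loneProb, inv_div, Nat.add_sub_cancel, expQuotCoeff_succ, sum_div]
  refine sum_congr rfl fun k hk => ?_
  rw [← expQuotCoeff_sub hn (Nat.lt_succ_iff.1 (mem_range.1 hk)), mul_div_assoc]

theorem loneProb_le_succ_left {n : ℕ} (hn : 1 ≤ n) (r : ℕ) :
    loneProb n r ≤ loneProb (n + 1) r := by
  obtain ⟨n, rfl⟩ := Nat.exists_eq_add_of_le' hn
  rcases Nat.eq_zero_or_pos n with rfl | hn0
  · rcases r with _ | r
    · simp [loneProb_zero_right]
    · rw [loneProb_one_succ]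
      exact loneProb_nonneg _ _
  · rw [← inv_le_inv₀ (loneProb_pos (by omega) r) (loneProb_pos (by omega) r), inv_loneProb hn0,
      inv_loneProb (by omega)]
    refine sum_le_sum fun k _ => mul_le_mul_of_nonneg_left ?_ (by positivity)
    exact prod_le_prod (fun i _ => coeffRatio_nonneg _ _) fun i _ => coeffRatio_succ_left_le hn0 _

end Ratios

/-! ### The probability as a mean over the number of removed vertices -/

section MeanValue

open Finset

/-- The expected weight of the ways to choose a set of `j` vertices that is a union of isolated
cycles, in a random digraph with `n` vertices and `n + r` arcs. -/
noncomputable def cycleWeight (n r j : ℕ) : ℝ :=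
  ∏ i ∈ range j, (loneProb (n - i) r ^ 2 * (((n - i : ℕ) : ℝ) / (((n - i : ℕ) : ℝ) + r)))

theorem cycleWeight_succ (n r j : ℕ) : cycleWeight n r (j + 1) =
    cycleWeight n r j * (loneProb (n - j) r ^ 2 * (((n - j : ℕ) : ℝ) / (((n - j : ℕ) : ℝ) + r))) :=
  prod_range_succ _ _

theorem cycleWeight_zero (n r : ℕ) : cycleWeight n r 0 = 1 := prod_range_zero _

theorem cycleWeight_nonneg (n r j : ℕ) : 0 ≤ cycleWeight n r j :=
  prod_nonneg fun _ _ => by positivity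

theorem cycleWeight_self {n r : ℕ} (hn : 1 ≤ n) (hr : 1 ≤ r) : cycleWeight n r n = 0 := by
  obtain ⟨n, rfl⟩ := Nat.exists_eq_add_of_le' hn
  obtain ⟨r, rfl⟩ := Nat.exists_eq_add_of_le' hr
  rw [cycleWeight_succ, Nat.add_sub_cancel_left, loneProb_one_succ]
  simp

theorem surjCount_sub_one {N r : ℕ} (hN : 1 ≤ N) :
    ((N : ℝ) + r) * surjCount (N - 1) (N + r - 1) = loneProb N r * surjCount N (N + r) := by
  obtain ⟨N, rfl⟩ := Nat.exists_eq_add_of_le' hN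
  rw [surjCount_eq, show N + 1 + r - 1 = N + r by omega, Nat.add_sub_cancel, surjCount_eq, loneProb,
    show N + 1 + r = N + r + 1 by ring, Nat.factorial_succ, Nat.add_sub_cancel]
  have := expQuotCoeff_pos hN r
  push_cast
  field_simp
  ring

theorem descFactorial_mul_surjCount (n r : ℕ) {j : ℕ} (hj : j ≤ n) :
    (n.descFactorial j : ℝ) * (n + r).descFactorial j * (surjCount (n - j) (n + r - j) : ℝ) ^ 2 =
      (surjCount n (n + r) : ℝ) ^ 2 * cycleWeight n r j := by
  induction j with
  | zero => simp [cycleWeight_zero]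
  | succ j ih =>
    have hN : 1 ≤ n - j := by omega
    have h := surjCount_sub_one (r := r) hN
    have hm : n + r - j = (n - j) + r := by omega
    rw [cycleWeight_succ, ← mul_assoc, ← ih (by omega), Nat.descFactorial_succ,
      Nat.descFactorial_succ, hm, show n + r - (j + 1) = n - j + r - 1 by omega, ← Nat.sub_sub]
    push_cast
    have hpos : (0 : ℝ) < ((n - j : ℕ) : ℝ) + r := by
      have : (1 : ℝ) ≤ ((n - j : ℕ) : ℝ) := by exact_mod_cast hN
      positivity
    have h2 : (surjCount (n - j - 1) (n - j + r - 1) : ℝ) ^ 2 =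
        (loneProb (n - j) r * surjCount (n - j) (n - j + r)) ^ 2 / (((n - j : ℕ) : ℝ) + r) ^ 2 := by
      rw [← h]
      field_simp
    rw [h2]
    field_simp

/-- The exact formula for the probability. -/
theorem probMG_eq_sum {n r : ℕ} (hn : 1 ≤ n) (hr : 1 ≤ r) :
    probMG n (n + r) (fun μ => μ.X = 0) = ∑ j ∈ range n, cycleWeight n r j *
      ((1 - loneProb (n - j) r) ^ 2 + loneProb (n - j) r ^ 2 *
        (r / ((((n - j : ℕ) : ℝ) - 1) * (((n - j : ℕ) : ℝ) + r)))) := by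
  have hS : (surjCount n (n + r) : ℝ) ≠ 0 :=
    Nat.cast_ne_zero.2 (surjCount_pos hn (by omega)).ne'
  rw [probMG_eq, natCard_no_soleClosed_eq (by omega), sum_div]
  refine sum_congr rfl fun j hj => ?_
  have hj : j < n := mem_range.1 hj
  have hN : 1 ≤ n - j := by omega
  have hN' : (1 : ℝ) ≤ ((n - j : ℕ) : ℝ) := by exact_mod_cast hN
  have hD := descFactorial_mul_surjCount n r hj.le
  have h := surjCount_sub_one (r := r) hN
  have hm : n + r - j = (n - j) + r := by omega
  rw [hm] at hD
  rw [show j + 2 = (j + 1) + 1 by ring, Nat.descFactorial_succ (n + r) (j + 1),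
    Nat.descFactorial_succ (n + r) j, hm, show n + r - (j + 1) = n - j + r - 1 by omega]
  rw [div_eq_iff (by positivity), mul_comm (cycleWeight n r j * _),
    ← mul_assoc ((surjCount n (n + r) : ℝ) ^ 2), ← hD]
  have hr' : (1 : ℝ) ≤ r := by exact_mod_cast hr
  have hpos : (0 : ℝ) < ((n - j : ℕ) : ℝ) + r := by positivity
  have hs : (surjCount (n - j - 1) (n - j + r - 1) : ℝ) =
      loneProb (n - j) r * surjCount (n - j) (n - j + r) / (((n - j : ℕ) : ℝ) + r) := by
    rw [← h]
    field_simp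
  rw [hs]
  have hc1 : ((n - j - 1 : ℕ) : ℝ) = ((n - j : ℕ) : ℝ) - 1 := by
    rw [Nat.cast_sub hN]; simp
  have hc2 : ((n - j + r - 1 : ℕ) : ℝ) = ((n - j : ℕ) : ℝ) + r - 1 := by
    rw [Nat.cast_sub (by omega)]; push_cast; ring
  rw [hc1]
  rcases Nat.eq_or_lt_of_le hN with h1 | h1
  · rw [← h1]
    obtain ⟨r, rfl⟩ := Nat.exists_eq_add_of_le' hr
    rw [loneProb_one_succ]
    simp
    ring
  · have h1' : (1 : ℝ) < ((n - j : ℕ) : ℝ) := by exact_mod_cast h1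
    have h2 : ((n - j : ℕ) : ℝ) - 1 ≠ 0 := by linarith
    push_cast [hc2]
    set N : ℝ := ((n - j : ℕ) : ℝ)
    field_simp
    ring

/-- The quotient `(1 - p)² / (1 - q)` in terms of `δ = 1 - p` and the excess `x` of the arc
density over `1`, where `q = p² / (1 + x)`. -/
noncomputable def excessQuot (δ x : ℝ) : ℝ := (1 + x) * δ ^ 2 / (x + 2 * δ - δ ^ 2)

theorem excessQuot_den_pos {δ x : ℝ} (hx : 0 < x) (h0 : 0 ≤ δ) (h1 : δ ≤ 1) :
    0 < x + 2 * δ - δ ^ 2 := by nlinarith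

theorem excessQuot_nonneg {δ x : ℝ} (hx : 0 < x) (h0 : 0 ≤ δ) (h1 : δ ≤ 1) :
    0 ≤ excessQuot δ x :=
  div_nonneg (by positivity) (excessQuot_den_pos hx h0 h1).le

theorem excessQuot_le_mul {δ δ' x c : ℝ} (hc : 1 ≤ c) (hx : 0 < x) (h0 : 0 ≤ δ) (h : δ ≤ δ')
    (h' : δ' ≤ c * δ) (h1 : δ' ≤ 1) : excessQuot δ x ≤ c * excessQuot δ' (c * x) := by
  have hD := excessQuot_den_pos hx h0 (h.trans h1)
  have hD' := excessQuot_den_pos (show 0 < c * x by positivity) (h0.trans h) h1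
  unfold excessQuot
  rw [← mul_div_assoc, div_le_div_iff₀ hD hD']
  have e1 : c * x + 2 * δ' - δ' ^ 2 ≤ c * (x + 2 * δ - δ ^ 2) := by nlinarith
  have e2 : (1 + x) * δ ^ 2 ≤ (1 + c * x) * δ' ^ 2 := by
    apply mul_le_mul _ (pow_le_pow_left₀ h0 h 2) (by positivity) (by positivity)
    nlinarith
  calc (1 + x) * δ ^ 2 * (c * x + 2 * δ' - δ' ^ 2)
      ≤ (1 + x) * δ ^ 2 * (c * (x + 2 * δ - δ ^ 2)) :=
        mul_le_mul_of_nonneg_left e1 (by positivity)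
    _ ≤ (1 + c * x) * δ' ^ 2 * (c * (x + 2 * δ - δ ^ 2)) :=
        mul_le_mul_of_nonneg_right e2 (by positivity)
    _ = _ := by ring

theorem excessQuot_le_pow_mul {δ δ' x c : ℝ} (hc : 1 ≤ c) (hx : 0 < x) (h0 : 0 ≤ δ) (h : δ ≤ δ')
    (h' : δ' ≤ c * δ) (h1 : δ' ≤ 1) : excessQuot δ' (c * x) ≤ c ^ 3 * excessQuot δ x := by
  have hD := excessQuot_den_pos hx h0 (h.trans h1)
  have e1 : x + 2 * δ - δ ^ 2 ≤ c * x + 2 * δ' - δ' ^ 2 := by nlinarith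
  have e2 : (1 + c * x) * δ' ^ 2 ≤ (c * (1 + x)) * (c * δ) ^ 2 := by
    apply mul_le_mul _ (pow_le_pow_left₀ (h0.trans h) h' 2) (by positivity) (by positivity)
    nlinarith
  unfold excessQuot
  calc (1 + c * x) * δ' ^ 2 / (c * x + 2 * δ' - δ' ^ 2)
      ≤ (c * (1 + x)) * (c * δ) ^ 2 / (x + 2 * δ - δ ^ 2) :=
        div_le_div₀ (by positivity) e2 hD e1
    _ = _ := by ring

/-- `excessQuot` at the exact probability of a one-point fibre. -/
noncomputable def loneQuot (n r : ℕ) : ℝ := excessQuot (1 - loneProb n r) ((r : ℝ) / n)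

theorem loneQuot_nonneg {n r : ℕ} (hn : 1 ≤ n) (hr : 1 ≤ r) : 0 ≤ loneQuot n r :=
  excessQuot_nonneg (by positivity) (by linarith [loneProb_le_one hn r])
    (by linarith [loneProb_nonneg n r])

theorem loneQuot_succ {n r : ℕ} (hn : 1 ≤ n) (hr : 1 ≤ r) :
    (n : ℝ) * loneQuot (n + 1) r ≤ (n + 1) * loneQuot n r ∧
    (n : ℝ) ^ 3 * loneQuot n r ≤ (n + 1) ^ 3 * loneQuot (n + 1) r := by
  have hn' : (1 : ℝ) ≤ n := by exact_mod_cast hn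
  have hx : (0 : ℝ) < (r : ℝ) / (n + 1 : ℕ) := by positivity
  have hc : (1 : ℝ) ≤ (n + 1) / n := by rw [le_div_iff₀ (by linarith)]; linarith
  have h0 : 0 ≤ 1 - loneProb (n + 1) r := by linarith [loneProb_le_one (show 1 ≤ n + 1 by omega) r]
  have h : 1 - loneProb (n + 1) r ≤ 1 - loneProb n r := by linarith [loneProb_le_succ_left hn r]
  have h' : 1 - loneProb n r ≤ (n + 1) / n * (1 - loneProb (n + 1) r) := by
    rw [div_mul_eq_mul_div, le_div_iff₀ (by linarith)]
    linarith [succ_mul_loneProb_le hn r]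
  have h1 : 1 - loneProb n r ≤ 1 := by linarith [loneProb_nonneg n r]
  have hxe : ((n : ℝ) + 1) / n * ((r : ℝ) / (n + 1 : ℕ)) = r / n := by
    push_cast
    field_simp
  have e1 := excessQuot_le_mul hc hx h0 h h' h1
  have e2 := excessQuot_le_pow_mul hc hx h0 h h' h1
  rw [hxe] at e1 e2
  constructor
  · rw [div_mul_eq_mul_div, le_div_iff₀ (by linarith)] at e1
    unfold loneQuot
    linarith
  · rw [div_pow, div_mul_eq_mul_div, le_div_iff₀ (by positivity)] at e2
    unfold loneQuot
    linarith

theorem loneQuot_sub {n r : ℕ} (hr : 1 ≤ r) {j : ℕ} (hj : j < n) :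
    ((n - j : ℕ) : ℝ) * loneQuot n r ≤ n * loneQuot (n - j) r ∧
    ((n - j : ℕ) : ℝ) ^ 3 * loneQuot (n - j) r ≤ (n : ℝ) ^ 3 * loneQuot n r := by
  induction j with
  | zero => simp
  | succ j ih =>
    obtain ⟨i1, i2⟩ := ih (by omega)
    obtain ⟨N, hN⟩ : ∃ N, n - j = N + 1 := ⟨n - j - 1, by omega⟩
    have hN1 : n - (j + 1) = N := by omega
    have hN' : 1 ≤ N := by omega
    have hNr : (1 : ℝ) ≤ N := by exact_mod_cast hN'
    rw [hN] at i1 i2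
    rw [hN1]
    push_cast at i1 i2
    obtain ⟨s1, s2⟩ := loneQuot_succ hN' hr
    refine ⟨?_, s2.trans i2⟩
    have : ((N : ℝ) + 1) * (N * loneQuot n r) ≤ (N + 1) * (n * loneQuot N r) := by
      have a1 := mul_le_mul_of_nonneg_left i1 (show (0 : ℝ) ≤ N by linarith)
      have a2 := mul_le_mul_of_nonneg_left s1 (show (0 : ℝ) ≤ n by positivity)
      linarith
    exact le_of_mul_le_mul_left this (by linarith)

theorem cycleWeight_mul_sq {n r : ℕ} (hr : 1 ≤ r) {j : ℕ} (hj : j < n) :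
    cycleWeight n r j * (1 - loneProb (n - j) r) ^ 2 =
      (cycleWeight n r j - cycleWeight n r (j + 1)) * loneQuot (n - j) r := by
  have hN : 1 ≤ n - j := by omega
  have hN' : (1 : ℝ) ≤ ((n - j : ℕ) : ℝ) := by exact_mod_cast hN
  have hr' : (1 : ℝ) ≤ r := by exact_mod_cast hr
  have hD := excessQuot_den_pos (x := (r : ℝ) / ((n - j : ℕ) : ℝ)) (δ := 1 - loneProb (n - j) r)
    (by positivity) (by linarith [loneProb_le_one hN r]) (by linarith [loneProb_nonneg (n - j) r])
  rw [cycleWeight_succ, loneQuot, excessQuot]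
  set N : ℝ := ((n - j : ℕ) : ℝ)
  set u := loneProb (n - j) r
  rw [← mul_div_assoc, eq_div_iff hD.ne']
  field_simp
  ring

/-- Powers of `n / (n - j)` do not spoil the geometric decay of the weights. -/
theorem cycleWeight_mul_pow_le {n r : ℕ} (hr : 60 ≤ r) {j : ℕ} (hj : j < n) :
    cycleWeight n r j * ((n : ℝ) / ((n - j : ℕ) : ℝ)) ^ 4 ≤ (((n : ℝ) + 30) / (n + r)) ^ j := by
  induction j with
  | zero =>
    have : (n : ℝ) ≠ 0 := Nat.cast_ne_zero.2 (by omega)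
    simp [cycleWeight_zero, this]
  | succ j ih =>
    have ih := ih (by omega)
    obtain ⟨M, hM⟩ : ∃ M, n - j = M + 1 := ⟨n - j - 1, by omega⟩
    have hM1 : n - (j + 1) = M := by omega
    have hM' : 1 ≤ M := by omega
    have hMr : (1 : ℝ) ≤ M := by exact_mod_cast hM'
    have hMn : (M : ℝ) + 1 ≤ n := by exact_mod_cast (show M + 1 ≤ n by omega)
    have hr' : (60 : ℝ) ≤ r := by exact_mod_cast hr
    rw [cycleWeight_succ, pow_succ, hM1]
    rw [hM] at ih ⊢
    push_cast at ih ⊢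
    have hu : loneProb (M + 1) r ^ 2 ≤ 1 :=
      pow_le_one₀ (loneProb_nonneg _ _) (loneProb_le_one (by omega) r)
    have hq : loneProb (M + 1) r ^ 2 * (((M : ℝ) + 1) / (M + 1 + r)) * (((M : ℝ) + 1) / M) ^ 4 ≤
        ((n : ℝ) + 30) / (n + r) := by
      have h1 : (((M : ℝ) + 1) / (M + 1 + r)) * (((M : ℝ) + 1) / M) ^ 4 ≤
          ((M : ℝ) + 31) / (M + 1 + r) := by
        rw [div_pow, div_mul_div_comm, div_le_div_iff₀ (by positivity) (by positivity)]
        have h2 : ((M : ℝ) + 1) * (M + 1) ^ 4 ≤ (M + 31) * M ^ 4 := by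
          obtain ⟨y, hy⟩ : ∃ y : ℝ, (M : ℝ) = 1 + y := ⟨M - 1, by ring⟩
          have hy0 : 0 ≤ y := by linarith
          rw [hy]
          have : 0 ≤ 74 * y + 126 * y ^ 2 + 94 * y ^ 3 + 26 * y ^ 4 := by positivity
          nlinarith [this, pow_nonneg hy0 2, pow_nonneg hy0 3, pow_nonneg hy0 4]
        calc ((M : ℝ) + 1) * (M + 1) ^ 4 * (M + 1 + r) ≤ ((M + 31) * M ^ 4) * (M + 1 + r) :=
              mul_le_mul_of_nonneg_right h2 (by positivity)
          _ = _ := by ring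
      have h3 : ((M : ℝ) + 31) / (M + 1 + r) ≤ ((n : ℝ) + 30) / (n + r) := by
        rw [div_le_div_iff₀ (by positivity) (by positivity)]
        nlinarith
      rw [mul_assoc]
      exact (mul_le_of_le_one_left (by positivity) hu).trans (h1.trans h3)
    calc cycleWeight n r j * (loneProb (M + 1) r ^ 2 * (((M : ℝ) + 1) / (M + 1 + r))) *
          ((n : ℝ) / M) ^ 4
        = (cycleWeight n r j * ((n : ℝ) / (M + 1)) ^ 4) *
          (loneProb (M + 1) r ^ 2 * (((M : ℝ) + 1) / (M + 1 + r)) * (((M : ℝ) + 1) / M) ^ 4) := by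
          field_simp
      _ ≤ (((n : ℝ) + 30) / (n + r)) ^ j * (((n : ℝ) + 30) / (n + r)) :=
          mul_le_mul ih hq (by positivity) (by positivity)

theorem sum_cycleWeight_mul_pow_le {n r : ℕ} (hr : 60 ≤ r) :
    ∑ j ∈ range n, cycleWeight n r j * ((n : ℝ) / ((n - j : ℕ) : ℝ)) ^ 4 ≤ 2 * (n + r) / r := by
  have hr' : (60 : ℝ) ≤ r := by exact_mod_cast hr
  have hθ : ((n : ℝ) + 30) / (n + r) < 1 := by
    rw [div_lt_one (by positivity)]
    linarith
  calc _ ≤ ∑ j ∈ range n, (((n : ℝ) + 30) / (n + r)) ^ j :=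
        sum_le_sum fun j hj => cycleWeight_mul_pow_le hr (mem_range.1 hj)
    _ ≤ (1 - ((n : ℝ) + 30) / (n + r))⁻¹ := by
        rw [← tsum_geometric_of_lt_one (by positivity) hθ]
        exact (summable_geometric_of_lt_one (by positivity) hθ).sum_le_tsum _
          fun _ _ => by positivity
    _ ≤ 2 * (n + r) / r := by
        have : 1 - ((n : ℝ) + 30) / (n + r) = (r - 30) / (n + r) := by field_simp; ring
        rw [this, inv_div, div_le_div_iff₀ (by linarith) (by linarith)]
        nlinarith [(Nat.cast_nonneg n : (0 : ℝ) ≤ n)]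

theorem sum_sub_mul_by_parts (s h : ℕ → ℝ) (k : ℕ) :
    ∑ j ∈ range (k + 1), (s j - s (j + 1)) * h j =
      s 0 * h 0 + ∑ j ∈ range k, s (j + 1) * (h (j + 1) - h j) - s (k + 1) * h k := by
  induction k with
  | zero => simp; ring
  | succ k ih => rw [sum_range_succ, ih, sum_range_succ _ k]; ring

theorem sum_cycleWeight_sub_mul {n r : ℕ} (hn : 1 ≤ n) (hr : 1 ≤ r) (h : ℕ → ℝ) :
    ∑ j ∈ range n, (cycleWeight n r j - cycleWeight n r (j + 1)) * h j =
      h 0 + ∑ j ∈ range (n - 1), cycleWeight n r (j + 1) * (h (j + 1) - h j) := by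
  obtain ⟨k, rfl⟩ := Nat.exists_eq_add_of_le' hn
  rw [sum_sub_mul_by_parts, cycleWeight_self hn hr, cycleWeight_zero, Nat.add_sub_cancel]
  ring

theorem sum_cycleWeight_succ_mul_pow_le {n r : ℕ} (hn : 1 ≤ n) (hr : 60 ≤ r) :
    ∑ j ∈ range (n - 1), cycleWeight n r (j + 1) * ((n : ℝ) / ((n - (j + 1) : ℕ) : ℝ)) ^ 4 ≤
      2 * (n + r) / r := by
  refine le_trans ?_ (sum_cycleWeight_mul_pow_le (n := n) hr)
  obtain ⟨k, rfl⟩ := Nat.exists_eq_add_of_le' hn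
  rw [sum_range_succ' _ k, Nat.add_sub_cancel]
  have : 0 ≤ cycleWeight (k + 1) r 0 * (((k + 1 : ℕ) : ℝ) / ((k + 1 - 0 : ℕ) : ℝ)) ^ 4 :=
    mul_nonneg (cycleWeight_nonneg _ _ _) (by positivity)
  linarith

theorem cycleWeight_succ_le {n r j : ℕ} (hj : j < n) :
    cycleWeight n r (j + 1) ≤ cycleWeight n r j := by
  rw [cycleWeight_succ]
  refine mul_le_of_le_one_right (cycleWeight_nonneg _ _ _) (mul_le_one₀ ?_ (by positivity) ?_)
  · exact pow_le_one₀ (loneProb_nonneg _ _) (loneProb_le_one (by omega) r)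
  · exact div_le_one_of_le₀ (by linarith [(Nat.cast_nonneg r : (0 : ℝ) ≤ r)]) (by positivity)

theorem loneQuot_mul_le_probMG {n r : ℕ} (hn : 1 ≤ n) (hr : 60 ≤ r) :
    loneQuot n r * (1 - 2 * ((n : ℝ) + r) / r / n) ≤ probMG n (n + r) (fun μ => μ.X = 0) := by
  have hr1 : 1 ≤ r := by omega
  have hn' : (1 : ℝ) ≤ n := by exact_mod_cast hn
  rw [probMG_eq_sum hn hr1]
  calc loneQuot n r * (1 - 2 * ((n : ℝ) + r) / r / n)
      ≤ loneQuot n r * (1 - (∑ j ∈ range (n - 1), cycleWeight n r (j + 1)) / n) := by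
        refine mul_le_mul_of_nonneg_left ?_ (loneQuot_nonneg hn hr1)
        refine sub_le_sub_left (div_le_div_of_nonneg_right ?_ (by positivity)) 1
        refine le_trans (sum_le_sum fun j hj => ?_) (sum_cycleWeight_succ_mul_pow_le hn hr)
        have hj : j < n - 1 := mem_range.1 hj
        refine le_mul_of_one_le_right (cycleWeight_nonneg _ _ _) (one_le_pow₀ ?_)
        have h0 : (0 : ℝ) < ((n - (j + 1) : ℕ) : ℝ) := by exact_mod_cast (by omega)
        rw [le_div_iff₀ h0, one_mul]
        exact_mod_cast Nat.sub_le _ _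
    _ = ∑ j ∈ range n, (cycleWeight n r j - cycleWeight n r (j + 1)) *
          (loneQuot n r * ((n : ℝ) - j) / n) := by
        rw [sum_cycleWeight_sub_mul hn hr1]
        have : ∀ j : ℕ, loneQuot n r * ((n : ℝ) - (j + 1 : ℕ)) / n -
            loneQuot n r * ((n : ℝ) - j) / n = -loneQuot n r / n := by
          intro j; push_cast; ring
        simp_rw [this]
        rw [← sum_mul]
        push_cast
        field_simp
        ring
    _ ≤ ∑ j ∈ range n, cycleWeight n r j * (1 - loneProb (n - j) r) ^ 2 := by
        refine sum_le_sum fun j hj => ?_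
        have hj : j < n := mem_range.1 hj
        rw [cycleWeight_mul_sq hr1 hj]
        refine mul_le_mul_of_nonneg_left ?_ (sub_nonneg.2 (cycleWeight_succ_le hj))
        rw [div_le_iff₀ (by linarith), ← Nat.cast_sub hj.le]
        linarith [(loneQuot_sub hr1 hj).1]
    _ ≤ _ := by
        refine sum_le_sum fun j hj => mul_le_mul_of_nonneg_left ?_ (cycleWeight_nonneg _ _ _)
        have hj : j < n := mem_range.1 hj
        have h1 : (1 : ℝ) ≤ ((n - j : ℕ) : ℝ) := by exact_mod_cast (by omega : 1 ≤ n - j)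
        have : 0 ≤ loneProb (n - j) r ^ 2 *
            (r / ((((n - j : ℕ) : ℝ) - 1) * (((n - j : ℕ) : ℝ) + r))) :=
          mul_nonneg (sq_nonneg _) (div_nonneg (by positivity)
            (mul_nonneg (by linarith) (by positivity)))
        linarith

theorem probMG_le_loneQuot_mul {n r : ℕ} (hn : 1 ≤ n) (hr : 60 ≤ r) :
    probMG n (n + r) (fun μ => μ.X = 0) ≤
      loneQuot n r * (1 + 3 * (2 * ((n : ℝ) + r) / r) / n) + 2 * ((n : ℝ) + r) / (n : ℝ) ^ 2 := by
  have hr1 : 1 ≤ r := by omega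
  have hr' : (1 : ℝ) ≤ r := by exact_mod_cast hr1
  have hn' : (1 : ℝ) ≤ n := by exact_mod_cast hn
  rw [probMG_eq_sum hn hr1]
  rw [sum_congr rfl fun j _ => mul_add _ _ _, sum_add_distrib]
  have hH := sum_cycleWeight_succ_mul_pow_le hn hr
  set H := ∑ j ∈ range (n - 1), cycleWeight n r (j + 1) * ((n : ℝ) / ((n - (j + 1) : ℕ) : ℝ)) ^ 4
    with hHdef
  refine add_le_add ?_ ?_
  · calc ∑ j ∈ range n, cycleWeight n r j * (1 - loneProb (n - j) r) ^ 2
        ≤ ∑ j ∈ range n, (cycleWeight n r j - cycleWeight n r (j + 1)) *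
          (loneQuot n r * ((n : ℝ) / ((n - j : ℕ) : ℝ)) ^ 3) := by
          refine sum_le_sum fun j hj => ?_
          have hj : j < n := mem_range.1 hj
          have h0 : (0 : ℝ) < ((n - j : ℕ) : ℝ) := by exact_mod_cast (by omega)
          rw [cycleWeight_mul_sq hr1 hj]
          refine mul_le_mul_of_nonneg_left ?_ (sub_nonneg.2 (cycleWeight_succ_le hj))
          rw [div_pow, ← mul_div_assoc, le_div_iff₀ (by positivity)]
          linarith [(loneQuot_sub hr1 hj).2]
      _ ≤ loneQuot n r * (1 + 3 * H / n) := by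
          rw [sum_cycleWeight_sub_mul hn hr1, Nat.sub_zero, div_self (by positivity), one_pow,
            mul_one, mul_add, mul_one, hHdef, mul_sum, sum_div, mul_sum]
          refine add_le_add le_rfl (sum_le_sum fun j hj => ?_)
          have hj : j < n - 1 := mem_range.1 hj
          obtain ⟨N, hN⟩ : ∃ N, n - j = N + 1 := ⟨n - j - 1, by omega⟩
          have hN1 : n - (j + 1) = N := by omega
          have hNr : (1 : ℝ) ≤ N := by exact_mod_cast (show 1 ≤ N by omega)
          rw [hN1, hN]
          have hkey : ((n : ℝ) / N) ^ 3 - ((n : ℝ) / ((N + 1 : ℕ) : ℝ)) ^ 3 ≤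
              3 * ((n : ℝ) / N) ^ 4 / n := by
            have e : ((n : ℝ) / N) ^ 3 - ((n : ℝ) / ((N + 1 : ℕ) : ℝ)) ^ 3 =
                (n : ℝ) ^ 3 * ((3 * N ^ 2 + 3 * N + 1) / (N ^ 3 * (N + 1) ^ 3)) := by
              push_cast
              field_simp
              ring
            have e2 : 3 * ((n : ℝ) / N) ^ 4 / n = (n : ℝ) ^ 3 * (3 / N ^ 4) := by
              field_simp
            rw [e, e2]
            refine mul_le_mul_of_nonneg_left ?_ (by positivity)
            rw [div_le_div_iff₀ (by positivity) (by positivity)]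
            have : (3 * (N : ℝ) ^ 2 + 3 * N + 1) * N ≤ 3 * (N + 1) ^ 3 := by nlinarith
            calc (3 * (N : ℝ) ^ 2 + 3 * N + 1) * (N : ℝ) ^ 4 =
                  ((3 * (N : ℝ) ^ 2 + 3 * N + 1) * N) * (N : ℝ) ^ 3 := by ring
              _ ≤ (3 * ((N : ℝ) + 1) ^ 3) * (N : ℝ) ^ 3 := mul_le_mul_of_nonneg_right this (by positivity)
              _ = _ := by ring
          calc cycleWeight n r (j + 1) * (loneQuot n r * ((n : ℝ) / N) ^ 3 -
                loneQuot n r * ((n : ℝ) / ((N + 1 : ℕ) : ℝ)) ^ 3)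
              = (cycleWeight n r (j + 1) * loneQuot n r) *
                (((n : ℝ) / N) ^ 3 - ((n : ℝ) / ((N + 1 : ℕ) : ℝ)) ^ 3) := by ring
            _ ≤ (cycleWeight n r (j + 1) * loneQuot n r) * (3 * ((n : ℝ) / N) ^ 4 / n) :=
                mul_le_mul_of_nonneg_left hkey
                  (mul_nonneg (cycleWeight_nonneg _ _ _) (loneQuot_nonneg hn hr1))
            _ = _ := by ring
      _ ≤ _ := by
          refine mul_le_mul_of_nonneg_left ?_ (loneQuot_nonneg hn hr1)
          gcongr
  · have hterm : ∀ j ∈ range n, cycleWeight n r j * (loneProb (n - j) r ^ 2 *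
        (r / ((((n - j : ℕ) : ℝ) - 1) * (((n - j : ℕ) : ℝ) + r)))) =
        cycleWeight n r (j + 1) * (r / (((n - j : ℕ) : ℝ) * (((n - j : ℕ) : ℝ) - 1))) := by
      intro j hj
      have hj : j < n := mem_range.1 hj
      have h0 : (0 : ℝ) < ((n - j : ℕ) : ℝ) := by exact_mod_cast (by omega)
      rw [cycleWeight_succ]
      set N : ℝ := ((n - j : ℕ) : ℝ)
      rcases eq_or_ne (N - 1) 0 with h1 | h1
      · simp [h1]
      · field_simp
    rw [sum_congr rfl hterm]
    have hsplit : ∑ j ∈ range n, cycleWeight n r (j + 1) *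
        (r / (((n - j : ℕ) : ℝ) * (((n - j : ℕ) : ℝ) - 1))) =
        ∑ j ∈ range (n - 1), cycleWeight n r (j + 1) *
        (r / (((n - j : ℕ) : ℝ) * (((n - j : ℕ) : ℝ) - 1))) := by
      conv_lhs => rw [show n = n - 1 + 1 by omega, sum_range_succ]
      rw [show n - 1 + 1 = n by omega, cycleWeight_self hn hr1, zero_mul, add_zero]
    rw [hsplit]
    calc _ ≤ ∑ j ∈ range (n - 1), (r : ℝ) / (n : ℝ) ^ 2 *
          (cycleWeight n r (j + 1) * ((n : ℝ) / ((n - (j + 1) : ℕ) : ℝ)) ^ 4) := by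
          refine sum_le_sum fun j hj => ?_
          have hj : j < n - 1 := mem_range.1 hj
          obtain ⟨N, hN⟩ : ∃ N, n - j = N + 1 := ⟨n - j - 1, by omega⟩
          have hN1 : n - (j + 1) = N := by omega
          have hNr : (1 : ℝ) ≤ N := by exact_mod_cast (show 1 ≤ N by omega)
          have hNn : (N : ℝ) ≤ n := by exact_mod_cast (show N ≤ n by omega)
          rw [hN1, hN]
          push_cast
          rw [add_sub_cancel_right]
          have : (r : ℝ) / ((N + 1) * N) ≤ r / (n : ℝ) ^ 2 * ((n : ℝ) / N) ^ 4 := by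
            have e : (r : ℝ) / (n : ℝ) ^ 2 * ((n : ℝ) / N) ^ 4 = r * ((n : ℝ) ^ 2 / N ^ 4) := by
              field_simp
            rw [e, div_eq_mul_one_div]
            refine mul_le_mul_of_nonneg_left ?_ (by positivity)
            rw [div_le_div_iff₀ (by positivity) (by positivity), one_mul]
            have : (N : ℝ) ^ 2 ≤ n ^ 2 := pow_le_pow_left₀ (by linarith) hNn 2
            calc (N : ℝ) ^ 4 = (N : ℝ) ^ 2 * ((N : ℝ) * N) := by ring
              _ ≤ (n : ℝ) ^ 2 * (((N : ℝ) + 1) * N) := by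
                apply mul_le_mul this _ (by positivity) (by positivity)
                nlinarith
          calc _ ≤ cycleWeight n r (j + 1) * (r / (n : ℝ) ^ 2 * ((n : ℝ) / N) ^ 4) :=
                mul_le_mul_of_nonneg_left this (cycleWeight_nonneg _ _ _)
            _ = _ := by ring
      _ = (r : ℝ) / (n : ℝ) ^ 2 * H := by rw [← mul_sum]
      _ ≤ (r : ℝ) / (n : ℝ) ^ 2 * (2 * (n + r) / r) :=
          mul_le_mul_of_nonneg_left hH (by positivity)
      _ = _ := by field_simp

end MeanValue

/-! ### The Poisson parameter -/

section PoissonParam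

open Set

/-- The probability `λ / (e ^ λ - 1)` that a Poisson variable with parameter `λ`, conditioned on
being positive, equals `1`. -/
noncomputable def truncPoissonOne (x : ℝ) : ℝ := x / (Real.exp x - 1)

theorem exp_sub_one_pos {x : ℝ} (hx : 0 < x) : 0 < Real.exp x - 1 := by
  linarith [Real.add_one_lt_exp hx.ne']

theorem truncPoissonOne_pos {x : ℝ} (hx : 0 < x) : 0 < truncPoissonOne x :=
  div_pos hx (exp_sub_one_pos hx)

theorem truncPoissonOne_le_one {x : ℝ} (hx : 0 < x) : truncPoissonOne x ≤ 1 :=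
  div_le_one_of_le₀ (by linarith [Real.add_one_le_exp x]) (exp_sub_one_pos hx).le

theorem hasDerivAt_truncPoissonOne {x : ℝ} (hx : 0 < x) : HasDerivAt truncPoissonOne
    ((Real.exp x - 1 - x * Real.exp x) / (Real.exp x - 1) ^ 2) x := by
  have h : HasDerivAt truncPoissonOne
      ((1 * (Real.exp x - 1) - x * Real.exp x) / (Real.exp x - 1) ^ 2) x :=
    (hasDerivAt_id x).div ((Real.hasDerivAt_exp x).sub_const 1) (exp_sub_one_pos hx).ne'
  rwa [one_mul] at h

theorem continuousOn_truncPoissonOne : ContinuousOn truncPoissonOne (Ioi 0) :=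
  fun _ hx => (hasDerivAt_truncPoissonOne hx).continuousAt.continuousWithinAt

theorem truncPoissonOne_antitone {x y : ℝ} (hx : 0 < x) (hxy : x ≤ y) :
    truncPoissonOne y ≤ truncPoissonOne x := by
  have : AntitoneOn truncPoissonOne (Ioi 0) := by
    refine antitoneOn_of_deriv_nonpos (convex_Ioi 0) continuousOn_truncPoissonOne ?_ ?_
    · rw [interior_Ioi]
      exact fun z hz => (hasDerivAt_truncPoissonOne hz).differentiableAt.differentiableWithinAt
    · rw [interior_Ioi]
      intro z hz
      rw [(hasDerivAt_truncPoissonOne hz).deriv]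
      refine div_nonpos_of_nonpos_of_nonneg ?_ (sq_nonneg _)
      have h1 := Real.add_one_le_exp (-z)
      have h2 : Real.exp (-z) * Real.exp z = 1 := by rw [← Real.exp_add]; simp
      nlinarith [Real.exp_pos z]
  exact this hx (hx.trans_le hxy) hxy

/-- `truncPoissonOne` has derivative at least `-1/2`; this is the inequality `x ≤ sinh x`. -/
theorem truncPoissonOne_le_add {x y : ℝ} (hx : 0 < x) (hxy : x ≤ y) :
    truncPoissonOne x ≤ truncPoissonOne y + (y - x) / 2 := by
  have hd : ∀ z, 0 < z → HasDerivAt (fun z => truncPoissonOne z + z / 2)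
      ((Real.exp z - 1 - z * Real.exp z) / (Real.exp z - 1) ^ 2 + 1 / 2) z := fun z hz =>
    (hasDerivAt_truncPoissonOne hz).add ((hasDerivAt_id z).div_const 2)
  have : MonotoneOn (fun z => truncPoissonOne z + z / 2) (Ioi 0) := by
    refine monotoneOn_of_deriv_nonneg (convex_Ioi 0)
      (fun z hz => (hd z hz).continuousAt.continuousWithinAt) ?_ ?_
    · rw [interior_Ioi]
      exact fun z hz => (hd z hz).differentiableAt.differentiableWithinAt
    · rw [interior_Ioi]
      intro z hz
      rw [(hd z hz).deriv]
      have hpos := exp_sub_one_pos hz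
      have hs := Real.self_le_sinh_iff.2 (le_of_lt hz)
      rw [Real.sinh_eq] at hs
      have h2 : Real.exp (-z) * Real.exp z = 1 := by rw [← Real.exp_add]; simp
      have h3 : 2 * z * Real.exp z ≤ Real.exp z ^ 2 - 1 := by
        have := mul_le_mul_of_nonneg_right hs (Real.exp_pos z).le
        nlinarith
      have e : (Real.exp z - 1 - z * Real.exp z) / (Real.exp z - 1) ^ 2 + 1 / 2 =
          (Real.exp z ^ 2 - 1 - 2 * z * Real.exp z) / (2 * (Real.exp z - 1) ^ 2) := by
        field_simp
        ring
      rw [e]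
      exact div_nonneg (by linarith) (by positivity)
  have h := this (mem_Ioi.2 hx) (mem_Ioi.2 (hx.trans_le hxy)) hxy
  simp only at h
  linarith

theorem mul_exp_div_eq {x : ℝ} (hx : 0 < x) :
    x * Real.exp x / (Real.exp x - 1) = x + truncPoissonOne x := by
  have := exp_sub_one_pos hx
  unfold truncPoissonOne
  field_simp
  ring

theorem abs_sub_le_of_add_truncPoissonOne {x y ε : ℝ} (hx : 0 < x) (hy : 0 < y)
    (h : |(x + truncPoissonOne x) - (y + truncPoissonOne y)| ≤ ε) : |x - y| ≤ 2 * ε := by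
  rw [abs_le] at h ⊢
  rcases le_total x y with hxy | hxy
  · have := truncPoissonOne_le_add hx hxy
    constructor <;> linarith
  · have := truncPoissonOne_le_add hy hxy
    constructor <;> linarith

theorem exists_isPoissonParam {n m : ℕ} (hn : 1 ≤ n) (h : n < m) :
    ∃ lam : ℝ, IsPoissonParam n m lam ∧ ∀ x : ℝ, IsPoissonParam n m x → x = lam := by
  have hn' : (1 : ℝ) ≤ n := by exact_mod_cast hn
  have hρ : (1 : ℝ) < m / n := by
    rw [one_lt_div (by linarith)]
    exact_mod_cast h
  set ρ : ℝ := m / n with hρdef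
  have hcont : ContinuousOn (fun x => x + truncPoissonOne x) (Icc (ρ - 1) ρ) :=
    continuousOn_id.add (continuousOn_truncPoissonOne.mono fun x hx =>
      mem_Ioi.2 (by linarith [hx.1]))
  obtain ⟨lam, hlam, heq⟩ := intermediate_value_Icc (by linarith) hcont
    (show ρ ∈ Icc ((ρ - 1) + truncPoissonOne (ρ - 1)) (ρ + truncPoissonOne ρ) from
      ⟨by linarith [truncPoissonOne_le_one (show 0 < ρ - 1 by linarith)],
        by linarith [truncPoissonOne_pos (show 0 < ρ by linarith)]⟩)
  have hpos : 0 < lam := by linarith [hlam.1]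
  refine ⟨lam, ⟨hpos, by rw [mul_exp_div_eq hpos]; exact heq⟩, fun x hx => ?_⟩
  have h1 := hx.2
  rw [mul_exp_div_eq hx.1, ← hρdef, ← heq] at h1
  have := abs_sub_le_of_add_truncPoissonOne hx.1 hpos (ε := 0) (by
    simp only at h1
    rw [h1]; simp)
  rw [mul_zero] at this
  exact sub_eq_zero.1 (abs_eq_zero.1 (le_antisymm this (abs_nonneg _)))

theorem div_two_mul_exp_le {x : ℝ} (hx : 0 < x) :
    x / (2 * Real.exp x) ≤ 1 - truncPoissonOne x := by
  have hpos := exp_sub_one_pos hx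
  have e : 1 - truncPoissonOne x = (Real.exp x - 1 - x) / (Real.exp x - 1) := by
    unfold truncPoissonOne
    field_simp
  have h1 := Real.quadratic_le_exp_of_nonneg hx.le
  have h2 : Real.exp x - 1 ≤ x * Real.exp x := by
    have h1 := Real.add_one_le_exp (-x)
    have h2 : Real.exp (-x) * Real.exp x = 1 := by rw [← Real.exp_add]; simp
    nlinarith [Real.exp_pos x]
  rw [e, div_le_div_iff₀ (by positivity) hpos]
  calc x * (Real.exp x - 1) ≤ x * (x * Real.exp x) := mul_le_mul_of_nonneg_left h2 hx.le
    _ = (x ^ 2 / 2) * (2 * Real.exp x) := by ring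
    _ ≤ _ := mul_le_mul_of_nonneg_right (by linarith) (by positivity)

/-- The leading term is `excessQuot` at the limiting probability. -/
theorem leadingTerm_eq {n m : ℕ} {lam : ℝ} (h : IsPoissonParam n m lam) :
    leadingTerm lam = excessQuot (1 - truncPoissonOne lam) ((m : ℝ) / n - 1) := by
  obtain ⟨hpos, heq⟩ := h
  have h1 := exp_sub_one_pos hpos
  have hp := truncPoissonOne_pos hpos
  have hρ := heq
  rw [mul_exp_div_eq hpos] at hρ
  have hp1 := truncPoissonOne_le_one hpos
  unfold leadingTerm excessQuot
  have e1 : lam / (Real.exp lam * (Real.exp lam - 1)) =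
      truncPoissonOne lam ^ 2 / (lam + truncPoissonOne lam) := by
    rw [← mul_exp_div_eq hpos]
    unfold truncPoissonOne
    field_simp
  rw [e1, ← hρ]
  change (1 - truncPoissonOne lam) ^ 2 / _ = _
  set p := truncPoissonOne lam
  have hs : 0 < lam + p := by linarith
  have hD : 0 < lam + p - p ^ 2 := by nlinarith
  have e2 : 1 - p ^ 2 / (lam + p) = (lam + p - p ^ 2) / (lam + p) := by field_simp
  have e3 : lam + p - 1 + 2 * (1 - p) - (1 - p) ^ 2 = lam + p - p ^ 2 := by ring
  rw [e2, e3]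
  field_simp
  ring

end PoissonParam

/-! ### Comparison of the one-point probability with its limit -/

section Comparison

open Finset

theorem coeffRatio_pos {n r : ℕ} (hn : 1 ≤ n) (hr : 1 ≤ r) : 0 < coeffRatio n r := by
  obtain ⟨r, rfl⟩ := Nat.exists_eq_add_of_le' hr
  rw [coeffRatio_succ]
  exact div_pos (expQuotCoeff_pos hn _) (expQuotCoeff_pos hn _)

theorem mul_sum_pow_div_factorial (V : ℝ) (K : ℕ) :
    V * ∑ k ∈ range K, 1 / ((k + 1).factorial : ℝ) * V ^ k =
      ∑ i ∈ range (K + 1), V ^ i / (i.factorial : ℝ) - 1 := by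
  rw [sum_range_succ', mul_sum]
  simp only [pow_zero, Nat.factorial_zero, Nat.cast_one, div_one, add_sub_cancel_right]
  exact sum_congr rfl fun k _ => by ring

theorem truncPoissonOne_le_loneProb {n r : ℕ} (hn : 1 ≤ n) (hr : 1 ≤ r) :
    truncPoissonOne (coeffRatio n r) ≤ loneProb (n + 1) r := by
  have hV := coeffRatio_pos hn hr
  have hu := loneProb_pos (show 2 ≤ n + 1 by omega) r
  have hinv := inv_loneProb hn r
  set V := coeffRatio n r with hVdef
  have h1 : (loneProb (n + 1) r)⁻¹ ≤ ∑ k ∈ range (r + 1), 1 / ((k + 1).factorial : ℝ) * V ^ k := by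
    rw [hinv]
    refine sum_le_sum fun k _ => mul_le_mul_of_nonneg_left ?_ (by positivity)
    calc ∏ i ∈ range k, coeffRatio n (r - i) ≤ ∏ _i ∈ range k, V :=
          prod_le_prod (fun i _ => coeffRatio_nonneg _ _)
            fun i _ => coeffRatio_mono_right hn (Nat.sub_le r i)
      _ = V ^ k := by simp
  have h2 : V * (loneProb (n + 1) r)⁻¹ ≤ Real.exp V - 1 := by
    refine (mul_le_mul_of_nonneg_left h1 hV.le).trans ?_
    rw [mul_sum_pow_div_factorial]
    linarith [Real.sum_le_exp_of_nonneg hV.le (r + 1 + 1)]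
  unfold truncPoissonOne
  rw [div_le_iff₀ (exp_sub_one_pos hV)]
  rw [← div_eq_mul_inv, div_le_iff₀ hu] at h2
  linarith

theorem pow_sub_le_prod_coeffRatio {n : ℕ} (hn : 1 ≤ n) (r k : ℕ) :
    coeffRatio n r ^ k - (k : ℝ) * (k - 1) / n * coeffRatio n r ^ (k - 1) ≤
      ∏ i ∈ range k, coeffRatio n (r - i) := by
  have hn' : (1 : ℝ) ≤ n := by exact_mod_cast hn
  set V := coeffRatio n r with hVdef
  have hV : 0 ≤ V := coeffRatio_nonneg n r
  induction k with
  | zero => simp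
  | succ k ih =>
    have hP0 : 0 ≤ ∏ i ∈ range k, coeffRatio n (r - i) := prod_nonneg fun _ _ => coeffRatio_nonneg _ _
    have hP1 : ∏ i ∈ range k, coeffRatio n (r - i) ≤ V ^ k := by
      calc ∏ i ∈ range k, coeffRatio n (r - i) ≤ ∏ _i ∈ range k, V :=
            prod_le_prod (fun i _ => coeffRatio_nonneg _ _)
              fun i _ => coeffRatio_mono_right hn (Nat.sub_le r i)
        _ = V ^ k := by simp
    rw [prod_range_succ, Nat.add_sub_cancel]
    have h1 := mul_le_mul_of_nonneg_left (coeffRatio_sub_le hn r k) hP0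
    have h2 := mul_le_mul_of_nonneg_right ih hV
    have h3 := mul_le_mul_of_nonneg_left hP1 (show (0 : ℝ) ≤ 2 * k / n by positivity)
    have e : (k : ℝ) * (k - 1) / n * V ^ (k - 1) * V = (k : ℝ) * (k - 1) / n * V ^ k := by
      rcases k with _ | k
      · simp
      · rw [Nat.add_sub_cancel, pow_succ]; ring
    rw [sub_mul, e] at h2
    rw [← hVdef] at h1
    push_cast
    have e2 : ((k : ℝ) + 1) * (k + 1 - 1) / n * V ^ k =
        (k : ℝ) * (k - 1) / n * V ^ k + 2 * k / n * V ^ k := by ring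
    rw [e2, pow_succ]
    linarith

theorem loneProb_le_truncPoissonOne_add {n r : ℕ} (hn : 1 ≤ n) (hr : 1 ≤ r) :
    loneProb (n + 1) r ≤ truncPoissonOne (coeffRatio n r) + Real.exp (coeffRatio n r) / n := by
  have hn' : (1 : ℝ) ≤ n := by exact_mod_cast hn
  have hV := coeffRatio_pos hn hr
  have hu := loneProb_pos (show 2 ≤ n + 1 by omega) r
  have hu1 := loneProb_le_one (show 1 ≤ n + 1 by omega) r
  have hinv := inv_loneProb hn r
  have hprod := pow_sub_le_prod_coeffRatio hn r
  set V := coeffRatio n r with hVdef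
  -- the terms with `k > r` vanish, so the sum for the inverse may be extended arbitrarily
  have hext : ∀ K, r + 1 ≤ K → ∑ k ∈ range K, 1 / ((k + 1).factorial : ℝ) *
      ∏ i ∈ range k, coeffRatio n (r - i) = (loneProb (n + 1) r)⁻¹ := by
    intro K hK
    rw [hinv]
    symm
    refine sum_subset (range_subset_range.2 hK) fun k _ hk => ?_
    have hk : r < k := by
      rw [mem_range] at hk
      omega
    rw [prod_eq_zero (mem_range.2 hk), mul_zero]
    rw [Nat.sub_self, coeffRatio_zero_right]
  have herr : ∀ K : ℕ, ∑ k ∈ range (K + 1), 1 / ((k + 1).factorial : ℝ) *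
      ((k : ℝ) * (k - 1) / n * V ^ (k - 1)) ≤ Real.exp V / n := by
    intro K
    rw [sum_range_succ']
    simp only [Nat.cast_zero, zero_mul, zero_div, mul_zero, add_zero]
    calc _ ≤ ∑ k ∈ range K, V ^ k / (k.factorial : ℝ) / n := by
          refine sum_le_sum fun k _ => ?_
          rw [Nat.add_sub_cancel, Nat.factorial_succ (k + 1), Nat.factorial_succ k]
          push_cast
          have hf : (0 : ℝ) < k.factorial := by positivity
          have e : 1 / (((k : ℝ) + 1 + 1) * ((k + 1) * k.factorial)) *
              ((k + 1) * (k + 1 - 1) / n * V ^ k) =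
              V ^ k / (k.factorial : ℝ) / n * (k / (k + 1 + 1)) := by
            field_simp
            ring
          rw [e]
          refine mul_le_of_le_one_right (by positivity) (div_le_one_of_le₀ (by linarith) (by positivity))
      _ = (∑ k ∈ range K, V ^ k / (k.factorial : ℝ)) / n := by rw [sum_div]
      _ ≤ Real.exp V / n :=
          div_le_div_of_nonneg_right (Real.sum_le_exp_of_nonneg hV.le K) (by linarith)
  have hbound : ∀ K, r + 1 ≤ K → ∑ i ∈ range (K + 1 + 1), V ^ i / (i.factorial : ℝ) ≤
      V * ((loneProb (n + 1) r)⁻¹ + Real.exp V / n) + 1 := by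
    intro K hK
    have h1 : ∑ k ∈ range (K + 1), 1 / ((k + 1).factorial : ℝ) * V ^ k ≤
        (loneProb (n + 1) r)⁻¹ + Real.exp V / n := by
      rw [← hext (K + 1) (by omega)]
      refine le_trans ?_ (add_le_add_right (herr K) _)
      rw [← sum_add_distrib]
      refine sum_le_sum fun k _ => ?_
      rw [← mul_add]
      exact mul_le_mul_of_nonneg_left (by linarith [hprod k]) (by positivity)
    have h2 := mul_le_mul_of_nonneg_left h1 hV.le
    rw [mul_sum_pow_div_factorial] at h2
    linarith
  have hlim : Real.exp V ≤ V * ((loneProb (n + 1) r)⁻¹ + Real.exp V / n) + 1 := by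
    have hs : HasSum (fun i : ℕ => V ^ i / (i.factorial : ℝ)) (Real.exp V) := by
      rw [Real.exp_eq_exp_ℝ]
      exact NormedSpace.expSeries_div_hasSum_exp V
    refine le_of_tendsto hs.tendsto_sum_nat ?_
    filter_upwards [Filter.eventually_ge_atTop (r + 1 + 1 + 1)] with K hK
    obtain ⟨K, rfl⟩ : ∃ K', K = K' + 1 + 1 := ⟨K - 2, by omega⟩
    exact hbound K (by omega)
  have hp := truncPoissonOne_pos hV
  have hp1 := truncPoissonOne_le_one hV
  have hφ : (truncPoissonOne V)⁻¹ ≤ (loneProb (n + 1) r)⁻¹ + Real.exp V / n := by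
    unfold truncPoissonOne
    rw [inv_div, div_le_iff₀ hV]
    linarith
  set u := loneProb (n + 1) r
  set p := truncPoissonOne V
  have hE : 0 ≤ Real.exp V / n := by positivity
  have h3 : u ≤ p + u * p * (Real.exp V / n) := by
    have := mul_le_mul_of_nonneg_left hφ (mul_pos hu hp).le
    have e1 : u * p * p⁻¹ = u := by field_simp
    have e2 : u * p * (u⁻¹ + Real.exp V / n) = p + u * p * (Real.exp V / n) := by field_simp
    rw [e1, e2] at this
    exact this
  have h4 : u * p * (Real.exp V / n) ≤ Real.exp V / n :=
    mul_le_of_le_one_left hE (mul_le_one₀ hu1 hp.le hp1)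
  linarith

/-- The probability of a one-point fibre is within `O(1 / n)` of its limit. -/
theorem abs_loneProb_sub_le {n r : ℕ} {B lam : ℝ} (hn : 1 ≤ n) (hr : 1 ≤ r)
    (hB : 2 * (r : ℝ) / n ≤ B) (h : IsPoissonParam (n + 1) (n + 1 + r) lam) :
    |loneProb (n + 1) r - truncPoissonOne lam| ≤ 2 * (Real.exp B / n) := by
  have hn' : (1 : ℝ) ≤ n := by exact_mod_cast hn
  have hV := coeffRatio_pos hn hr
  have hv := coeffRatio_pos (show 1 ≤ n + 1 by omega) hr
  have hVB := (coeffRatio_le hn r).trans hB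
  have hvV := coeffRatio_succ_left_le hn r
  have hVv := coeffRatio_le_succ_mul hn r
  have h1 := truncPoissonOne_le_loneProb hn hr
  have h2 := loneProb_le_truncPoissonOne_add hn hr
  have h3 := loneProb_add_coeffRatio (show 1 ≤ n + 1 by omega) r
  have hρ := h.2
  rw [mul_exp_div_eq h.1] at hρ
  have hρ' : lam + truncPoissonOne lam = loneProb (n + 1) r + coeffRatio (n + 1) r := by
    rw [hρ, h3]
    push_cast
    field_simp
  have h4 := truncPoissonOne_le_add hv hvV
  have h5 := truncPoissonOne_antitone hv hvV
  have hexp : Real.exp (coeffRatio n r) / n ≤ Real.exp B / n :=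
    div_le_div_of_nonneg_right (Real.exp_le_exp.2 hVB) (by linarith)
  have hdiff : coeffRatio n r - coeffRatio (n + 1) r ≤ Real.exp B / n := by
    have hBexp : B ≤ Real.exp B := by linarith [Real.add_one_le_exp B]
    rw [le_div_iff₀ (by linarith)]
    linarith
  have key := abs_sub_le_of_add_truncPoissonOne hv h.1 (ε := Real.exp B / n) (by
    rw [hρ', abs_le]
    constructor <;> linarith [Real.exp_pos B, show 0 ≤ Real.exp B / n by positivity])
  have : loneProb (n + 1) r - truncPoissonOne lam = -(coeffRatio (n + 1) r - lam) := by linarith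
  rw [this, abs_neg]
  exact key

theorem excessQuot_mono {δ δ' x : ℝ} (hx : 0 < x) (h0 : 0 ≤ δ) (h : δ ≤ δ') (h1 : δ' ≤ 1) :
    excessQuot δ x ≤ excessQuot δ' x := by
  have hD := excessQuot_den_pos hx h0 (h.trans h1)
  have hD' := excessQuot_den_pos hx (h0.trans h) h1
  unfold excessQuot
  rw [div_le_div_iff₀ hD hD', mul_assoc, mul_assoc]
  refine mul_le_mul_of_nonneg_left ?_ (by linarith)
  have e : δ' ^ 2 * (x + 2 * δ - δ ^ 2) - δ ^ 2 * (x + 2 * δ' - δ' ^ 2) =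
      (δ' - δ) * (x * (δ' + δ) + 2 * δ * δ') := by ring
  have : 0 ≤ (δ' - δ) * (x * (δ' + δ) + 2 * δ * δ') :=
    mul_nonneg (by linarith) (add_nonneg (mul_nonneg hx.le (by linarith))
      (mul_nonneg (by linarith) (by linarith)))
  linarith

theorem sq_mul_excessQuot_le {δ x t : ℝ} (hx : 0 < x) (h0 : 0 ≤ δ) (h1 : δ ≤ 1) (ht0 : 0 ≤ t)
    (ht : t ≤ 1) : t ^ 2 * excessQuot δ x ≤ excessQuot (t * δ) x := by
  have htd : t * δ ≤ δ := mul_le_of_le_one_left h0 ht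
  have hD := excessQuot_den_pos hx h0 h1
  have hD' := excessQuot_den_pos hx (mul_nonneg ht0 h0) (htd.trans h1)
  unfold excessQuot
  rw [← mul_div_assoc]
  refine div_le_div₀ (by positivity) (le_of_eq (by ring)) hD' ?_
  nlinarith

/-- A relative error `η` in `δ` gives a relative error `O(η)` in `excessQuot δ x`. -/
theorem excessQuot_close {δ δ' x η : ℝ} (hx : 0 < x) (h0 : 0 ≤ δ) (h1 : δ ≤ 1) (h0' : 0 ≤ δ')
    (h1' : δ' ≤ 1) (hη0 : 0 ≤ η) (hη : η ≤ 1) (h : |δ' - δ| ≤ η * δ) :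
    (1 - 3 * η) * excessQuot δ x ≤ excessQuot δ' x ∧
      excessQuot δ' x ≤ (1 + 3 * η) * excessQuot δ x := by
  rw [abs_le] at h
  have hF := excessQuot_nonneg hx h0 h1
  have hF' := excessQuot_nonneg hx h0' h1'
  constructor
  · have e1 := sq_mul_excessQuot_le hx h0 h1 (show 0 ≤ 1 - η by linarith) (by linarith)
    have e2 := excessQuot_mono hx (mul_nonneg (by linarith) h0)
      (show (1 - η) * δ ≤ δ' by linarith) h1'
    have : (1 - 3 * η) * excessQuot δ x ≤ (1 - η) ^ 2 * excessQuot δ x :=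
      mul_le_mul_of_nonneg_right (by nlinarith) hF
    linarith
  · have hpos : 0 < 1 + η := by linarith
    have e1 := sq_mul_excessQuot_le hx h0' h1' (show 0 ≤ (1 + η)⁻¹ by positivity)
      (inv_le_one_of_one_le₀ (by linarith))
    have e2 := excessQuot_mono hx (show 0 ≤ (1 + η)⁻¹ * δ' by positivity)
      (show (1 + η)⁻¹ * δ' ≤ δ by rw [inv_mul_le_iff₀ hpos]; linarith) h1
    have e3 := e1.trans e2
    rw [inv_pow, inv_mul_le_iff₀ (by positivity)] at e3
    refine e3.trans (mul_le_mul_of_nonneg_right ?_ hF)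
    nlinarith

theorem mul_le_excessQuot {δ x c : ℝ} (hx : 0 < x) (h1 : δ ≤ 1) (hc0 : 0 ≤ c) (hc : c ≤ 1)
    (h : c * x ≤ δ) : c ^ 2 * x / 3 ≤ excessQuot δ x := by
  have hcx : 0 ≤ c * x := by positivity
  refine le_trans ?_ (excessQuot_mono hx hcx h h1)
  have hD := excessQuot_den_pos hx hcx (h.trans h1)
  unfold excessQuot
  rw [div_le_div_iff₀ (by norm_num) hD]
  have e1 : x + 2 * (c * x) - (c * x) ^ 2 ≤ 3 * x := by nlinarith
  calc c ^ 2 * x * (x + 2 * (c * x) - (c * x) ^ 2) ≤ c ^ 2 * x * (3 * x) :=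
        mul_le_mul_of_nonneg_left e1 (by positivity)
    _ = 1 * (c * x) ^ 2 * 3 := by ring
    _ ≤ (1 + x) * (c * x) ^ 2 * 3 := by gcongr; linarith

end Comparison

/-! ### The asymptotic formula -/

/-- The estimate with error term `O(1 / r)`. -/
theorem abs_probMG_sub_leadingTerm_le {C c η₀ lam : ℝ} {n r : ℕ} (hn : 1 ≤ n) (hr : 60 ≤ r)
    (hm : (n : ℝ) + r ≤ C * n) (hc : c = 1 / (2 * Real.exp C))
    (hη₀ : η₀ = 4 * Real.exp (4 * C) / c) (hrη : η₀ ≤ r) (hrC : 2 * C ≤ r)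
    (hlam : IsPoissonParam n (n + r) lam) :
    |probMG n (n + r) (fun μ => μ.X = 0) - leadingTerm lam| ≤
      leadingTerm lam * ((3 * η₀ + 6 * C + 18 * η₀ * C + 6 * C / c ^ 2) / r) := by
  have hr' : (60 : ℝ) ≤ r := by exact_mod_cast hr
  have hn' : (1 : ℝ) ≤ n := by exact_mod_cast hn
  have hr0 : (0 : ℝ) < r := by linarith
  have hn0 : (0 : ℝ) < n := by linarith
  have hC : 1 ≤ C := by
    by_contra hcon
    push Not at hcon
    nlinarith
  have hn2 : 2 ≤ n := by
    by_contra hcon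
    have h1 : n = 1 := by omega
    rw [h1] at hm
    push_cast at hm
    linarith
  have hc0 : 0 < c := by rw [hc]; positivity
  have hc1 : c ≤ 1 := by
    rw [hc, div_le_one (by positivity)]
    linarith [Real.add_one_le_exp C]
  have hη₀pos : 0 ≤ η₀ := by rw [hη₀]; positivity
  set x : ℝ := (r : ℝ) / n with hxdef
  have hx : 0 < x := by positivity
  have hρ : ((n + r : ℕ) : ℝ) / n = 1 + x := by
    rw [hxdef]
    push_cast
    field_simp
  -- the excess of the limiting probability
  obtain ⟨hlam0, hlameq⟩ := id hlam
  rw [mul_exp_div_eq hlam0, hρ] at hlameq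
  have hp := truncPoissonOne_pos hlam0
  have hp1 := truncPoissonOne_le_one hlam0
  have hxC : 1 + x ≤ C := by
    rw [hxdef, ← sub_nonneg]
    have : C - (1 + r / n) = (C * n - (n + r)) / n := by field_simp
    rw [this]
    exact div_nonneg (by linarith) hn0.le
  have hδlow : c * x ≤ 1 - truncPoissonOne lam := by
    refine le_trans ?_ (div_two_mul_exp_le hlam0)
    rw [hc, div_mul_eq_mul_div, one_mul]
    apply div_le_div₀ hlam0.le (by linarith) (by positivity)
    have : Real.exp lam ≤ Real.exp C := Real.exp_le_exp.2 (by linarith)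
    linarith
  -- the exact probability is close to the limiting one
  have hclose : |(1 - loneProb n r) - (1 - truncPoissonOne lam)| ≤
      η₀ / r * (1 - truncPoissonOne lam) := by
    obtain ⟨N, rfl⟩ : ∃ N, n = N + 1 := ⟨n - 1, by omega⟩
    have hN : 1 ≤ N := by omega
    have hN' : (1 : ℝ) ≤ N := by exact_mod_cast hN
    have hB : 2 * (r : ℝ) / N ≤ 4 * C := by
      rw [div_le_iff₀ (by linarith)]
      push_cast at hm
      nlinarith
    have h1 := abs_loneProb_sub_le hN (by omega) hB hlam
    have e : (1 - loneProb (N + 1) r) - (1 - truncPoissonOne lam) =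
        -(loneProb (N + 1) r - truncPoissonOne lam) := by ring
    rw [e, abs_neg]
    refine h1.trans ?_
    calc 2 * (Real.exp (4 * C) / N) ≤ 4 * Real.exp (4 * C) / ((N + 1 : ℕ) : ℝ) := by
          rw [← mul_div_assoc, div_le_div_iff₀ (by linarith) (by positivity)]
          push_cast
          nlinarith [Real.exp_pos (4 * C)]
      _ = η₀ / r * (c * x) := by
          rw [hη₀, hxdef]
          field_simp
      _ ≤ _ := mul_le_mul_of_nonneg_left hδlow (by positivity)
  have hF := excessQuot_nonneg hx (show 0 ≤ 1 - truncPoissonOne lam by linarith) (by linarith)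
  have hη1 : η₀ / r ≤ 1 := div_le_one_of_le₀ hrη hr0.le
  obtain ⟨hlow, hup⟩ := excessQuot_close hx (show 0 ≤ 1 - truncPoissonOne lam by linarith)
    (by linarith) (show 0 ≤ 1 - loneProb n r by linarith [loneProb_le_one hn r])
    (by linarith [loneProb_nonneg n r]) (by positivity) hη1 hclose
  have hFlow := mul_le_excessQuot hx (show 1 - truncPoissonOne lam ≤ 1 by linarith) hc0.le hc1 hδlow
  have hlead : leadingTerm lam = excessQuot (1 - truncPoissonOne lam) x := by
    rw [leadingTerm_eq hlam, hρ, add_sub_cancel_left]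
  rw [hlead]
  change (1 - 3 * (η₀ / r)) * _ ≤ loneQuot n r at hlow
  change loneQuot n r ≤ _ at hup
  have hP1 := loneQuot_mul_le_probMG hn hr
  have hP2 := probMG_le_loneQuot_mul hn hr
  set P := probMG n (n + r) (fun μ => μ.X = 0)
  set F := excessQuot (1 - truncPoissonOne lam) x
  set η := η₀ / r with hηdef
  have hη0 : 0 ≤ η := by positivity
  have hF0 := loneQuot_nonneg hn (show 1 ≤ r by omega)
  have hCr : 0 ≤ C / r := by positivity
  have hmn : ((n : ℝ) + r) / n ≤ C := by rw [div_le_iff₀ hn0]; exact hm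
  have e1 : 2 * ((n : ℝ) + r) / r / n ≤ 2 * (C / r) := by
    have : 2 * ((n : ℝ) + r) / r / n = 2 * ((((n : ℝ) + r) / n) / r) := by field_simp
    rw [this]
    gcongr
  have e2 : 3 * (2 * ((n : ℝ) + r) / r) / n ≤ 6 * (C / r) := by
    have : 3 * (2 * ((n : ℝ) + r) / r) / n = 3 * (2 * ((n : ℝ) + r) / r / n) := by ring
    rw [this]
    linarith
  have e3 : 2 * ((n : ℝ) + r) / (n : ℝ) ^ 2 ≤ 6 * C / c ^ 2 / r * F := by
    calc 2 * ((n : ℝ) + r) / (n : ℝ) ^ 2 = 2 / n * (((n : ℝ) + r) / n) := by field_simp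
      _ ≤ 2 / n * C := by gcongr
      _ = 6 * C / c ^ 2 / r * (c ^ 2 * x / 3) := by
          rw [hxdef]
          field_simp
          norm_num
      _ ≤ _ := mul_le_mul_of_nonneg_left hFlow (by positivity)
  have hηC : η * (C / r) ≤ η₀ * C / r := by
    have : η * (C / r) = η₀ * C / r * (1 / r) := by rw [hηdef]; ring
    rw [this]
    exact mul_le_of_le_one_right (by positivity) (div_le_one_of_le₀ (by linarith) hr0.le)
  have hK : (3 * η₀ + 6 * C + 18 * η₀ * C + 6 * C / c ^ 2) / r =
      3 * η + 6 * (C / r) + 18 * (η₀ * C / r) + 6 * C / c ^ 2 / r := by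
    rw [hηdef]
    ring
  have hK4 : 0 ≤ 6 * C / c ^ 2 / r := by positivity
  have hK3 : 0 ≤ η₀ * C / r := by positivity
  have hCr1 : 2 * (C / r) ≤ 1 := by
    rw [← mul_div_assoc]
    exact div_le_one_of_le₀ hrC hr0.le
  rw [hK, abs_le]
  constructor
  · have h1 : (1 - 3 * η) * F * (1 - 2 * (C / r)) ≤ P :=
      (mul_le_mul_of_nonneg_right hlow (by linarith)).trans
        ((mul_le_mul_of_nonneg_left (by linarith) hF0).trans hP1)
    have h2 : 0 ≤ F * (6 * (η * (C / r)) + 4 * (C / r) + 18 * (η₀ * C / r) + 6 * C / c ^ 2 / r) := by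
      positivity
    have h3 : (1 - 3 * η) * F * (1 - 2 * (C / r)) =
        F - F * (3 * η + 6 * (C / r) + 18 * (η₀ * C / r) + 6 * C / c ^ 2 / r) +
        F * (6 * (η * (C / r)) + 4 * (C / r) + 18 * (η₀ * C / r) + 6 * C / c ^ 2 / r) := by ring
    linarith
  · have h1 : P ≤ (1 + 3 * η) * F * (1 + 6 * (C / r)) + 6 * C / c ^ 2 / r * F := by
      refine hP2.trans (add_le_add ?_ e3)
      exact mul_le_mul hup (by linarith) (by positivity) (by positivity)
    have h2 := mul_le_mul_of_nonneg_left hηC hF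
    have h3 : (1 + 3 * η) * F * (1 + 6 * (C / r)) + 6 * C / c ^ 2 / r * F =
        F + F * (3 * η + 6 * (C / r) + 6 * C / c ^ 2 / r) + 18 * (F * (η * (C / r))) := by ring
    linarith

theorem theorem4p2 (C : ℝ) :
    ∃ (K : ℝ) (R : ℕ), ∀ n m : ℕ, n + R ≤ m → (m : ℝ) ≤ C * (n : ℝ) →
      (insertionSeqs n m).Nonempty ∧
      (∀ s ∈ insertionSeqs n m,
        (resultingMultiDigraph s).X = 0 ↔ (resultingMultiDigraph s).NoSimpleSets) ∧
      ∃ lam : ℝ, IsPoissonParam n m lam ∧ (∀ x : ℝ, IsPoissonParam n m x → x = lam) ∧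
        |probMG n m (fun μ => μ.X = 0) - leadingTerm lam| ≤
          leadingTerm lam *
            (K * (Real.log ((m : ℝ) - (n : ℝ)) ^ 2 / ((m : ℝ) - (n : ℝ)))) := by
  -- `c * (r / n)` is a lower bound for the excess `1 - truncPoissonOne lam`, and `η₀ / r` bounds the
  -- relative error of `1 - loneProb n r`. The number 60 is what the decay estimate
  -- `cycleWeight_mul_pow_le` asks for. The error obtained is `O(1 / r)`, without the logarithm.
  obtain ⟨c, hc⟩ : ∃ c : ℝ, c = 1 / (2 * Real.exp C) := ⟨_, rfl⟩
  obtain ⟨η₀, hη₀⟩ : ∃ η₀ : ℝ, η₀ = 4 * Real.exp (4 * C) / c := ⟨_, rfl⟩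
  refine ⟨3 * η₀ + 6 * C + 18 * η₀ * C + 6 * C / c ^ 2, ⌈η₀⌉₊ + ⌈2 * C⌉₊ + 60,
    fun n m hnm hmC => ?_⟩
  obtain ⟨r, rfl⟩ : ∃ r, m = n + r := ⟨m - n, by omega⟩
  have hn : 1 ≤ n := by
    by_contra hcon
    have h0 : n = 0 := by omega
    rw [h0, Nat.cast_zero, mul_zero, zero_add] at hmC
    have : r = 0 := by exact_mod_cast le_antisymm hmC (Nat.cast_nonneg r)
    omega
  have hr : 60 ≤ r := by omega
  have hr' : (60 : ℝ) ≤ r := by exact_mod_cast hr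
  have hrη : η₀ ≤ r := (Nat.le_ceil _).trans (by exact_mod_cast (by omega : ⌈η₀⌉₊ ≤ r))
  have hrC : 2 * C ≤ r := (Nat.le_ceil _).trans (by exact_mod_cast (by omega : ⌈2 * C⌉₊ ≤ r))
  refine ⟨?_, fun s _ => X_eq_zero_iff _, ?_⟩
  · rw [← Finset.card_pos, card_insertionSeqs]
    exact pow_pos (surjCount_pos hn (by omega)) 2
  obtain ⟨lam, hlam, huniq⟩ := exists_isPoissonParam hn (show n < n + r by omega)
  refine ⟨lam, hlam, huniq, ?_⟩
  push_cast at hmC ⊢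
  rw [add_sub_cancel_left]
  have hmain := abs_probMG_sub_leadingTerm_le hn hr hmC hc hη₀ hrη hrC hlam
  have hlog : 1 ≤ Real.log r ^ 2 := by
    refine one_le_pow₀ ((Real.le_log_iff_exp_le (by linarith)).2 ?_)
    linarith [Real.exp_one_lt_d9]
  -- the bound just obtained shows that its right-hand side is nonnegative
  have hnonneg := (abs_nonneg _).trans hmain
  calc _ ≤ _ := hmain
    _ ≤ (leadingTerm lam * ((3 * η₀ + 6 * C + 18 * η₀ * C + 6 * C / c ^ 2) / r)) *
        Real.log r ^ 2 := le_mul_of_one_le_right hnonneg hlog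
    _ = _ := by ring
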